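/- Let $k$ be an algebraically closed field of characteristic $\neq 2$, let $V$ be a $k$-vector space of finite dimension $n \ge 5$ with a nondegenerate symmetric bilinear form $b$, and put $G = \mathrm{SO}(V,b)$ and $\mathfrak g = \mathfrak{so}(V,b)$, the Lie algebra of endomorphisms of $V$ that are skew-adjoint for $b$. Let $\lambda$ be the highest weight of the natural module $V$ of $G$. Then $\mathrm{Sym}^2(V)$ has a composition factor on which $G$ acts nontrivially, and every such composition factor $W$ is the irreducible module $L(2\lambda)$, i.e. $W$ has a highest weight vector of weight $2\lambda$. Moreover, every $x \in \mathfrak g$ that is nonzero nilpotent or noncentral semisimple satisfies $$\dim x^G + \dim W^x < \dim W,$$ where $x^G = \{ g x g^{-1} : g \in G(k)\}$ is the conjugacy class of $x$, $\dim x^G$ is its dimension as an algebraic variety, and $W^x = \{ w \in W : xw = 0\}$ for the differentiated action of $\mathfrak g$ on $W$. -/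

import Mathlib

open scoped TensorProduct

attribute [local instance 100] LieRing.ofAssociativeRing

noncomputable section

namespace SymSqSO

section Generic

variable {k : Type*} [Field k] {V : Type*} [AddCommGroup V] [Module k V]

/-- The special orthogonal group `SO(V, b)` (its group of `k`-points): the linear automorphisms of
determinant `1` which preserve the bilinear form `b`. -/
def specialOrthogonal (b : LinearMap.BilinForm k V) : Subgroup (V ≃ₗ[k] V) where
  carrier := {g | LinearEquiv.det g = 1 ∧ ∀ v w, b (g v) (g w) = b v w}
  one_mem' := ⟨map_one _, fun _ _ => rfl⟩
  mul_mem' := by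
    rintro g h ⟨hg, hg'⟩ ⟨hh, hh'⟩
    refine ⟨by rw [map_mul, hg, hh, one_mul], fun v w => ?_⟩
    rw [LinearEquiv.mul_apply, LinearEquiv.mul_apply, hg', hh']
  inv_mem' := by
    rintro g ⟨hg, hg'⟩
    refine ⟨by rw [map_inv, hg, inv_one], fun v w => ?_⟩
    rw [← hg', ← LinearEquiv.mul_apply, ← LinearEquiv.mul_apply, mul_inv_cancel]
    rfl

/-- The Lie algebra `𝔰𝔬(V, b)`: the endomorphisms `x` of `V` which are skew-adjoint for `b`, that
is, `b (x v) w = - b v (x w)`. -/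
abbrev soLie (b : LinearMap.BilinForm k V) : LieSubalgebra k (Module.End k V) :=
  skewAdjointLieSubalgebra b

variable (k V) in
/-- The subspace of `V ⊗ V` spanned by all `v ⊗ w - w ⊗ v`. -/
def symSqRel : Submodule k (V ⊗[k] V) :=
  Submodule.span k (Set.range fun p : V × V => p.1 ⊗ₜ[k] p.2 - p.2 ⊗ₜ[k] p.1)

variable (k V) in
/-- The symmetric square `Sym² V`, the quotient of `V ⊗ V` by all `v ⊗ w - w ⊗ v`. -/
abbrev SymSq : Type _ := (V ⊗[k] V) ⧸ symSqRel k V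

theorem symSqRel_le_map (f : V →ₗ[k] V) :
    symSqRel k V ≤ (symSqRel k V).comap (TensorProduct.map f f) := by
  refine Submodule.span_le.2 ?_
  rintro _ ⟨⟨v, w⟩, rfl⟩
  exact Submodule.subset_span ⟨(f v, f w), by simp⟩

/-- The map `v w ↦ (f v) (f w)` on `Sym² V`. -/
def symSqMap (f : V →ₗ[k] V) : SymSq k V →ₗ[k] SymSq k V :=
  (symSqRel k V).mapQ (symSqRel k V) (TensorProduct.map f f) (symSqRel_le_map f)

theorem symSqRel_le_der (x : Module.End k V) :
    symSqRel k V ≤ (symSqRel k V).comap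
      (TensorProduct.map x LinearMap.id + TensorProduct.map LinearMap.id x) := by
  refine Submodule.span_le.2 ?_
  rintro _ ⟨⟨v, w⟩, rfl⟩
  have h : (TensorProduct.map x LinearMap.id + TensorProduct.map LinearMap.id x :
      V ⊗[k] V →ₗ[k] V ⊗[k] V) (v ⊗ₜ[k] w - w ⊗ₜ[k] v) =
      (x v ⊗ₜ[k] w - w ⊗ₜ[k] x v) + (v ⊗ₜ[k] x w - x w ⊗ₜ[k] v) := by
    simp only [map_sub, LinearMap.add_apply, TensorProduct.map_tmul, LinearMap.id_apply]
    abel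
  simp only [Submodule.comap_coe, Set.mem_preimage, SetLike.mem_coe]
  rw [h]
  exact add_mem (Submodule.subset_span ⟨(x v, w), rfl⟩) (Submodule.subset_span ⟨(v, x w), rfl⟩)

/-- The differentiated action `v w ↦ (x v) w + v (x w)` of `x ∈ 𝔤𝔩(V)` on `Sym² V`. -/
def symSqDer (x : Module.End k V) : Module.End k (SymSq k V) :=
  (symSqRel k V).mapQ (symSqRel k V)
    (TensorProduct.map x LinearMap.id + TensorProduct.map LinearMap.id x) (symSqRel_le_der x)

/-- The natural representation of `SO(V, b)` on `Sym² V`, `g (v w) = (g v) (g w)`. -/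
def symSqRep (b : LinearMap.BilinForm k V) :
    Representation k (specialOrthogonal b) (SymSq k V) where
  toFun g := symSqMap (g : V ≃ₗ[k] V).toLinearMap
  map_one' := by
    refine Submodule.linearMap_qext _ (TensorProduct.ext' fun v w => ?_)
    simp [symSqMap]
  map_mul' g h := by
    refine Submodule.linearMap_qext _ (TensorProduct.ext' fun v w => ?_)
    simp [symSqMap]

section Subquotient

variable {b : LinearMap.BilinForm k V}

/-- The underlying vector space of the subquotient `B / A` of `Sym² V`, for `SO(V)`-submodules
`A ≤ B`. It is a composition factor of `Sym² V` exactly if `A ⋖ B`, i.e. there is no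
`SO(V)`-submodule strictly between `A` and `B`. -/
abbrev Subquotient (A B : Subrepresentation (symSqRep b)) : Type _ :=
  B.toSubmodule ⧸ A.toSubmodule.submoduleOf B.toSubmodule

/-- `SO(V)` acts nontrivially on `B / A`. -/
def ActsNontrivially (A B : Subrepresentation (symSqRep b)) : Prop :=
  ∃ g : specialOrthogonal b, ∃ w ∈ B, symSqRep b g w - w ∉ A

/-- The space `(B / A)^x` of vectors of `B / A` which are killed by `x ∈ 𝔰𝔬(V)`: the classes of
those `w ∈ B` with `x w ∈ A`. -/
def killedBy (A B : Subrepresentation (symSqRep b)) (x : soLie b) :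
    Submodule k (Subquotient A B) :=
  ((A.toSubmodule.comap (symSqDer (x : Module.End k V))).submoduleOf B.toSubmodule).map
    (A.toSubmodule.submoduleOf B.toSubmodule).mkQ

/-- A basis `e_0, …, e_m` of `V` is hyperbolic if `b (e_i, e_j)` is `1` for `i + j = m` and is `0`
otherwise. -/
def IsHyperbolicBasis (b : LinearMap.BilinForm k V) {m : ℕ}
    (e : Module.Basis (Fin (m + 1)) k V) : Prop :=
  ∀ i j, b (e i) (e j) = if j = i.rev then 1 else 0

/-- The elements of `SO(V)` which are upper triangular in the basis `e`, i.e. which stabilize all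
the subspaces `⟨e_0, …, e_i⟩`. When `e` is hyperbolic, they form a Borel subgroup of `SO(V)`. -/
def IsUpperTriangular {m : ℕ} (e : Module.Basis (Fin (m + 1)) k V)
    (g : specialOrthogonal b) : Prop :=
  ∀ i, (g : V ≃ₗ[k] V) (e i) ∈ Submodule.span k (e '' Set.Iic i)

/-- The subquotient `B / A` has a highest weight vector of weight `2 λ`, where `λ` is the highest
weight of the natural module `V`. For the Borel subgroup of elements of `SO(V)` that are upper
triangular in a hyperbolic basis `e`, the highest weight vector of `V` is `e_0`, so `λ` is the
character given by `g e_0 = λ(g) e_0`. The condition says that `B / A` contains a nonzero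
vector on which this Borel subgroup acts through the character `2 λ`, that is, `g ↦ λ(g) ^ 2`. -/
def HasHighestWeightTwoLambda (A B : Subrepresentation (symSqRep b)) : Prop :=
  ∀ (m : ℕ) (e : Module.Basis (Fin (m + 1)) k V), IsHyperbolicBasis b e →
    ∃ w ∈ B, w ∉ A ∧ ∀ g : specialOrthogonal b, IsUpperTriangular e g →
      ∀ c : k, (g : V ≃ₗ[k] V) (e 0) = c • e 0 → symSqRep b g w - c ^ 2 • w ∈ A

end Subquotient

/-- The `SO(V)`-conjugacy class `x^G = {g x g⁻¹ | g ∈ SO(V)}` of an endomorphism `x` of `V`. -/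
def conjClass (b : LinearMap.BilinForm k V) (x : Module.End k V) : Set (Module.End k V) :=
  Set.range fun g : specialOrthogonal b => (g : V ≃ₗ[k] V).conj x

/-- The `k`-algebra of polynomial functions on a subset `S` of a vector space `E`: the algebra of
functions `S → k` generated by the restrictions of the linear forms on `E`. For finite-dimensional
`E` it is the coordinate ring of the Zariski closure of `S`. -/
def polyFunctions {E : Type*} [AddCommGroup E] [Module k E] (S : Set E) : Subalgebra k (S → k) :=
  Algebra.adjoin k (Set.range fun (l : Module.Dual k E) (s : S) => l s)

/-- The dimension of (the Zariski closure of) a subset `S` of a finite-dimensional vector space: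
the Krull dimension of the coordinate ring of the Zariski closure. For a locally
closed `S`, such as an orbit of an algebraic group, this is the dimension of the variety `S`. -/
def zariskiDim {E : Type*} [AddCommGroup E] [Module k E] (S : Set E) : WithBot ℕ∞ :=
  ringKrullDim (polyFunctions (k := k) S)

end Generic

end SymSqSO

end

/-!
In an orthonormal basis of `V`, the group `SO(V)` becomes the group of orthogonal matrices of
determinant `1`, the Lie algebra the space `K` of skew-symmetric matrices, and `Sym² V` the space
`S` of symmetric matrices, on which `g` acts by `A ↦ g A gᵀ` and `x` by `A ↦ x A - A x`. Let `D` be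
the line of scalar matrices in `S` and `H` the hyperplane of matrices of trace zero.

**Composition factors.** A submodule of `S` which is not contained in `D` contains `H`
(`IsRotationStable.mem_of_trace_eq_zero`): changes of two signs at a time isolate an off-diagonal
entry, as there are at least five coordinates, and rotations in coordinate planes then give all of
`H`. As `D` and `S / H` are trivial modules, a subquotient `B / A` with nontrivial action has
`A ≤ D` and `H ≤ B`. One with `A ⋖ B` is `H / (D ⊓ H)`. The square of an isotropic vector lies
in `H` and not in `D`, and it provides the highest weight vector.

**The dimension of a class.** The dimension of `x^G` is at most `dim K - dim K^x`, where `K^x` is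
the centralizer of `x` in `K` (`zariskiDim_le_of_orbit`). This does not follow formally from the
dimension of the centralizer in the group, and orbit maps may be inseparable, so it is shown by a
parametrization. Up to finitely many diagonal sign matrices, every orthogonal matrix is a Cayley
transform of a skew-symmetric matrix. Hence the class is covered by finitely many images of open
subsets of `K`, and it is enough to see that polynomials which vanish on the image of a complement
`N` of `K^x` vanish on the whole image. If `z ∈ N` and `y ∈ K^x`, then the product of the Cayley
transforms of `t z` and `t y` is, over the power series in `t`, the Cayley transform of an arc `t M`
with `M(0) = z + y`, and it moves `x` to the same point as the transform of `t z` does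
(`exists_arc`). So the pullback of such a polynomial vanishes along arcs with all tangent
directions `z + y`, and its lowest homogeneous component is zero
(`exists_forall_aeval_X_mul_ne_zero`). The image of `N` has dimension at most `dim N` because
transcendence degree bounds the Krull dimension of finitely generated domains.

**Comparison of the centralizers.** For skew-symmetric `x`, the matrices in `S` (in `K`) which
commute with `x` are the symmetric (alternating) forms for which `x` is skew. The difference of the
dimensions of these two spaces of forms is additive over direct sums, so the decomposition into
cyclic `k[x]`-modules bounds it by `dim ker x` (`formsIndex_le_finrank_ker`). For `x = 0` it
is `n`. Therefore `dim K - dim K^x + dim S^x + rank x ≤ dim S`.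

**Conclusion.** The elements of `B` whose image under `x` lies in `A` have scalar commutator with
`x`, and they form a space of dimension at most `dim S^x + ε` with `ε ≤ 1`. A nonzero `x` has rank
at least `2`. If `ε = 1`, then a nonzero scalar matrix is a commutator with `x`, so
`n ≤ 2 * rank x` and the rank is at least `3`. As `dim B ≥ dim S - 1`, the inequality follows in
both cases. About `x` it only uses `x ≠ 0`, and a noncentral element is nonzero.
-/

noncomputable section

namespace SymSqSO

/-! ### Krull dimension and transcendence degree -/

theorem ringKrullDim_le_of_isIntegral {R S : Type*} [CommRing R] [CommRing S] (f : R →+* S)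
    (hf : f.IsIntegral) : ringKrullDim S ≤ ringKrullDim R := by
  algebraize [f]
  refine Order.krullDim_le_of_strictMono (PrimeSpectrum.comap f) fun p q hpq => ?_
  exact Ideal.IsIntegral.comap_lt_comap (R := R) (I := p.asIdeal) (J := q.asIdeal) hpq

theorem ringKrullDim_quotient_ker_le_trdeg {k : Type*} [Field k] {σ F : Type*} [Finite σ]
    [CommRing F] [IsDomain F] [Algebra k F] (ψ : MvPolynomial σ k →ₐ[k] F) (d : ℕ)
    (h : Algebra.trdeg k F ≤ d) :
    ringKrullDim (MvPolynomial σ k ⧸ RingHom.ker ψ) ≤ d := by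
  have : Nontrivial (MvPolynomial σ k ⧸ RingHom.ker ψ) :=
    Ideal.Quotient.nontrivial_iff.2 (RingHom.ker_ne_top ψ)
  obtain ⟨s, g, hg, hgi⟩ := exists_integral_inj_algHom_of_fg k (MvPolynomial σ k ⧸ RingHom.ker ψ)
  refine (ringKrullDim_le_of_isIntegral g.toRingHom hgi).trans ?_
  rw [MvPolynomial.ringKrullDim_of_isNoetherianRing, ringKrullDim_eq_zero_of_field, zero_add,
    Nat.card_fin]
  have h1 := lift_trdeg_le_of_injective ((Ideal.kerLiftAlg ψ).comp g)
    ((Ideal.kerLiftAlg_injective ψ).comp hg)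
  rw [MvPolynomial.trdeg_of_isDomain, Cardinal.mk_fin, Cardinal.lift_natCast,
    Cardinal.lift_natCast] at h1
  have h2 := h1.trans (Cardinal.lift_le.2 h)
  rw [Cardinal.lift_natCast, Nat.cast_le] at h2
  exact_mod_cast h2

theorem trdeg_localizationAway_mvPolynomial_le {k : Type*} [Field k] {τ : Type*} [Fintype τ]
    (Δ : MvPolynomial τ k) (hΔ : Δ ≠ 0) :
    Algebra.trdeg k (Localization.Away Δ) ≤ Fintype.card τ := by
  have hle : Submonoid.powers Δ ≤ nonZeroDivisors (MvPolynomial τ k) :=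
    powers_le_nonZeroDivisors_of_noZeroDivisors hΔ
  have : IsDomain (Localization.Away Δ) := IsLocalization.isDomain_localization hle
  have : FaithfulSMul (MvPolynomial τ k) (Localization.Away Δ) :=
    (faithfulSMul_iff_algebraMap_injective _ _).2 (IsLocalization.injective _ hle)
  have : Algebra.IsAlgebraic (MvPolynomial τ k) (Localization.Away Δ) :=
    IsLocalization.isAlgebraic _ (Submonoid.powers Δ)
  rw [← trdeg_add_eq k (MvPolynomial τ k) (A := Localization.Away Δ),
    MvPolynomial.trdeg_of_isDomain,
    (trdeg_eq_zero_iff (R := MvPolynomial τ k) (A := Localization.Away Δ)).2 this]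
  simp

/-- If a set is contained in the union of finitely many irreducible closed sets, given as the
kernels of homomorphisms to domains, then its dimension is at most the maximum of theirs. -/
theorem zariskiDim_le_of_family {k E : Type*} [Field k] [AddCommGroup E] [Module k E] {σ : Type*}
    [Fintype σ] (c : Module.Basis σ k E) (S : Set E) {I : Type*} [Fintype I] {F : I → Type*}
    [∀ i, CommRing (F i)] [∀ i, IsDomain (F i)] [∀ i, Algebra k (F i)]
    (ψ : ∀ i, MvPolynomial σ k →ₐ[k] F i)
    (hψ : ∀ P, (∀ i, ψ i P = 0) → ∀ s ∈ S, MvPolynomial.eval (c.repr s) P = 0) (d : ℕ)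
    (hd : ∀ i, ringKrullDim (MvPolynomial σ k ⧸ RingHom.ker (ψ i)) ≤ d) :
    zariskiDim (k := k) S ≤ d := by
  classical
  let π : MvPolynomial σ k →ₐ[k] (S → k) := MvPolynomial.aeval fun j s => c.coord j s
  have hπ (P) (s : S) : π P s = MvPolynomial.eval (c.repr (s : E)) P := by
    change Pi.evalAlgHom k (fun _ : S => k) s (π P) = _
    rw [← AlgHom.comp_apply, MvPolynomial.comp_aeval, MvPolynomial.aeval_eq_eval]
    rfl
  have hrange : polyFunctions (k := k) S ≤ π.range := by
    refine Algebra.adjoin_le ?_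
    rintro _ ⟨l, rfl⟩
    refine ⟨∑ j, MvPolynomial.C (l (c j)) * MvPolynomial.X j, ?_⟩
    ext s
    change π _ s = _
    rw [hπ]
    simp only [map_sum, map_mul, MvPolynomial.eval_C, MvPolynomial.eval_X]
    conv_rhs => rw [← c.sum_repr (s : E), map_sum]
    simp [mul_comm]
  have hmem (P) : π P ∈ polyFunctions (k := k) S := by
    have : π.range ≤ polyFunctions (k := k) S := by
      rw [← Algebra.map_top, ← MvPolynomial.adjoin_range_X, AlgHom.map_adjoin]
      refine Algebra.adjoin_mono ?_
      rintro _ ⟨_, ⟨j, rfl⟩, rfl⟩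
      exact ⟨c.coord j, by ext s; simp [π]⟩
    exact this ⟨P, rfl⟩
  let π' : MvPolynomial σ k →ₐ[k] polyFunctions (k := k) S := π.codRestrict _ hmem
  have hπ's : Function.Surjective π' := by
    rintro ⟨f, hf⟩
    obtain ⟨P, hP⟩ := hrange hf
    exact ⟨P, Subtype.ext hP⟩
  have hker : (Finset.univ.inf fun i => RingHom.ker (ψ i)) ≤ RingHom.ker π' := by
    intro P hP
    rw [Submodule.mem_finsetInf] at hP
    refine (RingHom.mem_ker).2 (Subtype.ext (funext fun s => ?_))
    exact (hπ P s).trans (hψ P (fun i => hP i (Finset.mem_univ i)) s s.2)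
  -- The first prime of a chain contains the kernel of some `ψ i`, since it contains their
  -- intersection.
  refine iSup_le fun l => ?_
  obtain ⟨i, -, hi⟩ := (Ideal.IsPrime.inf_le' (P := (l.head.asIdeal.comap π'))
    inferInstance).1 (hker.trans (Ideal.ker_le_comap _))
  have h1 : ringKrullDim ((polyFunctions (k := k) S) ⧸ l.head.asIdeal) ≤ d := by
    refine le_trans ?_ (hd i)
    refine ringKrullDim_le_of_surjective
      (Ideal.Quotient.lift _ ((Ideal.Quotient.mk l.head.asIdeal).comp π'.toRingHom)
        fun a ha => Ideal.Quotient.eq_zero_iff_mem.2 (hi ha)) ?_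
    exact Ideal.Quotient.lift_surjective_of_surjective _ _
      (Ideal.Quotient.mk_surjective.comp hπ's)
  have h2 : (l.length : WithBot ℕ∞) ≤
      ringKrullDim ((polyFunctions (k := k) S) ⧸ l.head.asIdeal) := by
    rw [ringKrullDim_quotient]
    let l' : LTSeries (PrimeSpectrum.zeroLocus (l.head.asIdeal : Set (polyFunctions (k := k) S))) :=
      { length := l.length
        toFun := fun j => ⟨l.toFun j, fun a ha => (l.head_le j) ha⟩
        step := fun j => l.step j }
    exact Order.LTSeries.length_le_krullDim l'
  exact h2.trans h1

/-! ### Symmetric and alternating forms for which an endomorphism is skew -/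

section Forms

variable {k : Type*} [Field k] {M N : Type*} [AddCommGroup M] [Module k M] [AddCommGroup N]
  [Module k N]

variable (k M N) in
/-- The bilinear pairings of `M` and `N`, encoded as linear forms on `M ⊗ N`. -/
def Pairing : Type _ := M ⊗[k] N →ₗ[k] k

namespace Pairing

instance : AddCommGroup (Pairing k M N) := inferInstanceAs (AddCommGroup (M ⊗[k] N →ₗ[k] k))

instance : Module k (Pairing k M N) := inferInstanceAs (Module k (M ⊗[k] N →ₗ[k] k))

instance [FiniteDimensional k M] [FiniteDimensional k N] : FiniteDimensional k (Pairing k M N) :=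
  inferInstanceAs (FiniteDimensional k (M ⊗[k] N →ₗ[k] k))

instance : FunLike (Pairing k M N) (M ⊗[k] N) k :=
  inferInstanceAs (FunLike (M ⊗[k] N →ₗ[k] k) (M ⊗[k] N) k)

instance : LinearMapClass (Pairing k M N) k (M ⊗[k] N) k :=
  inferInstanceAs (LinearMapClass (M ⊗[k] N →ₗ[k] k) k (M ⊗[k] N) k)

@[simp] theorem zero_apply (t : M ⊗[k] N) : (0 : Pairing k M N) t = 0 := rfl

@[simp] theorem add_apply (β γ : Pairing k M N) (t : M ⊗[k] N) : (β + γ) t = β t + γ t := rfl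

@[simp] theorem smul_apply (c : k) (β : Pairing k M N) (t : M ⊗[k] N) :
    (c • β) t = c * β t := rfl

theorem ext_tmul {β γ : Pairing k M N} (h : ∀ v w, β (v ⊗ₜ w) = γ (v ⊗ₜ w)) : β = γ :=
  TensorProduct.ext' h

/-- The pullback of a pairing along two linear maps. -/
def comap {M' N' : Type*} [AddCommGroup M'] [Module k M'] [AddCommGroup N'] [Module k N']
    (β : Pairing k M N) (f : M' →ₗ[k] M) (g : N' →ₗ[k] N) : Pairing k M' N' :=
  LinearMap.comp β (TensorProduct.map f g)

@[simp] theorem comap_tmul {M' N' : Type*} [AddCommGroup M'] [Module k M'] [AddCommGroup N']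
    [Module k N'] (β : Pairing k M N) (f : M' →ₗ[k] M) (g : N' →ₗ[k] N) (v : M') (w : N') :
    β.comap f g (v ⊗ₜ w) = β (f v ⊗ₜ g w) := rfl

/-- The pairing with the arguments exchanged. -/
def flip (β : Pairing k M N) : Pairing k N M :=
  LinearMap.comp β (TensorProduct.comm k N M).toLinearMap

@[simp] theorem flip_tmul (β : Pairing k M N) (v : N) (w : M) :
    β.flip (v ⊗ₜ w) = β (w ⊗ₜ v) := rfl

end Pairing

/-- The bilinear forms `β` on `M` for which `x` is skew and which satisfy `β w v = ε * β v w`: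
symmetric forms for `ε = 1`, and alternating forms for `ε = -1` if `2 ≠ 0`. -/
def skewForms (ε : k) (x : Module.End k M) : Submodule k (Pairing k M M) where
  carrier := {β | (∀ v w, β (w ⊗ₜ v) = ε * β (v ⊗ₜ w)) ∧ ∀ v w, β (x v ⊗ₜ w) = -β (v ⊗ₜ x w)}
  zero_mem' := by simp
  add_mem' := by
    rintro a b ⟨ha, ha'⟩ ⟨hb, hb'⟩
    refine ⟨fun v w => ?_, fun v w => ?_⟩
    · simp [ha v w, hb v w, mul_add]
    · simp [ha', hb', add_comm]
  smul_mem' := by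
    rintro c a ⟨ha, ha'⟩
    refine ⟨fun v w => ?_, fun v w => ?_⟩
    · simp [ha v w, mul_left_comm]
    · simp [ha']

/-- The pairings `γ` of `M` and `N` with `γ (x v) w = -γ v (y w)`. -/
def skewPairings (x : Module.End k M) (y : Module.End k N) : Submodule k (Pairing k M N) where
  carrier := {γ | ∀ v w, γ (x v ⊗ₜ w) = -γ (v ⊗ₜ y w)}
  zero_mem' := by simp
  add_mem' := by
    intro a b ha hb v w
    simp [ha v w, hb v w, add_comm]
  smul_mem' := by
    intro c a ha v w
    simp [ha v w]

theorem finrank_skewForms_congr (ε : k) (x : Module.End k M) (y : Module.End k N) (e : M ≃ₗ[k] N)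
    (h : ∀ v, e (x v) = y (e v)) :
    Module.finrank k (skewForms ε x) = Module.finrank k (skewForms ε y) := by
  have h' : ∀ w, e.symm (y w) = x (e.symm w) := fun w => by
    rw [LinearEquiv.symm_apply_eq, h, LinearEquiv.apply_symm_apply]
  refine LinearEquiv.finrank_eq
    { toFun := fun β => ⟨β.1.comap e.symm e.symm,
        fun v w => by simpa using β.2.1 (e.symm v) (e.symm w),
        fun v w => by simpa [h'] using β.2.2 (e.symm v) (e.symm w)⟩
      invFun := fun β => ⟨β.1.comap e e,
        fun v w => by simpa using β.2.1 (e v) (e w),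
        fun v w => by simpa [h] using β.2.2 (e v) (e w)⟩
      map_add' := fun _ _ => rfl
      map_smul' := fun _ _ => rfl
      left_inv := fun β => Subtype.ext (Pairing.ext_tmul fun v w => by simp)
      right_inv := fun β => Subtype.ext (Pairing.ext_tmul fun v w => by simp) }

/-- A form on `M × N` consists of its restrictions to `M` and `N` and a pairing of `M` and `N`. -/
def skewFormsProdEquiv (ε : k) (hε : ε * ε = 1) (x : Module.End k M) (y : Module.End k N) :
    skewForms ε (LinearMap.prodMap x y) ≃ₗ[k]
      (skewForms ε x × skewForms ε y) × skewPairings x y where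
  toFun β := ((⟨β.1.comap (LinearMap.inl k M N) (LinearMap.inl k M N),
      fun v w => by simpa using β.2.1 (v, 0) (w, 0),
      fun v w => by simpa using β.2.2 (v, 0) (w, 0)⟩,
    ⟨β.1.comap (LinearMap.inr k M N) (LinearMap.inr k M N),
      fun v w => by simpa using β.2.1 (0, v) (0, w),
      fun v w => by simpa using β.2.2 (0, v) (0, w)⟩),
    ⟨β.1.comap (LinearMap.inl k M N) (LinearMap.inr k M N),
      fun v w => by simpa using β.2.2 (v, 0) (0, w)⟩)
  map_add' _ _ := rfl
  map_smul' _ _ := rfl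
  invFun p := ⟨p.1.1.1.comap (LinearMap.fst k M N) (LinearMap.fst k M N) +
      p.1.2.1.comap (LinearMap.snd k M N) (LinearMap.snd k M N) +
      p.2.1.comap (LinearMap.fst k M N) (LinearMap.snd k M N) +
      ε • (p.2.1.comap (LinearMap.fst k M N) (LinearMap.snd k M N)).flip, by
    obtain ⟨⟨⟨a, ha⟩, ⟨b, hb⟩⟩, ⟨c, hc⟩⟩ := p
    refine ⟨fun v w => ?_, fun v w => ?_⟩
    · have h1 := ha.1 v.1 w.1
      have h2 := hb.1 v.2 w.2
      simp only [Pairing.add_apply, Pairing.comap_tmul, Pairing.smul_apply, Pairing.flip_tmul,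
        LinearMap.fst_apply, LinearMap.snd_apply]
      linear_combination (-c (w.1 ⊗ₜ v.2)) * hε + h1 + h2
    · have h1 := hc v.1 w.2
      have h2 := hc w.1 v.2
      have h3 := ha.2 v.1 w.1
      have h4 := hb.2 v.2 w.2
      simp only [Pairing.add_apply, Pairing.comap_tmul, Pairing.smul_apply, Pairing.flip_tmul,
        LinearMap.fst_apply, LinearMap.snd_apply, LinearMap.prodMap_apply]
      linear_combination h1 + ε * h2 + h3 + h4⟩
  left_inv β := by
    refine Subtype.ext (Pairing.ext_tmul fun v w => ?_)
    have h1 := β.2.1 (w.1, 0) (0, v.2)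
    have hv : v = (v.1, 0) + (0, v.2) := by simp
    have hw : w = (w.1, 0) + (0, w.2) := by simp
    conv_rhs => rw [hv, hw]
    simp only [Pairing.add_apply, Pairing.comap_tmul, Pairing.smul_apply, Pairing.flip_tmul,
        LinearMap.fst_apply, LinearMap.snd_apply,
        LinearMap.inl_apply, LinearMap.inr_apply, map_add, TensorProduct.add_tmul,
        TensorProduct.tmul_add, h1]
    ring
  right_inv p := by
    refine Prod.ext (Prod.ext (Subtype.ext ?_) (Subtype.ext ?_)) (Subtype.ext ?_) <;>
    exact Pairing.ext_tmul fun v w => by simp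

/-- The difference of the dimensions of the spaces of symmetric and of alternating forms for which
`x` is skew. -/
def formsIndex (x : Module.End k M) : ℤ :=
  (Module.finrank k (skewForms 1 x) : ℤ) - Module.finrank k (skewForms (-1) x)

theorem formsIndex_congr (x : Module.End k M) (y : Module.End k N) (e : M ≃ₗ[k] N)
    (h : ∀ v, e (x v) = y (e v)) : formsIndex x = formsIndex y := by
  rw [formsIndex, formsIndex, finrank_skewForms_congr _ x y e h, finrank_skewForms_congr _ x y e h]

variable [FiniteDimensional k M] [FiniteDimensional k N]

theorem formsIndex_prodMap (x : Module.End k M) (y : Module.End k N) :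
    formsIndex (LinearMap.prodMap x y) = formsIndex x + formsIndex y := by
  rw [formsIndex, formsIndex, formsIndex,
    (skewFormsProdEquiv 1 (by norm_num) x y).finrank_eq,
    (skewFormsProdEquiv (-1) (by norm_num) x y).finrank_eq]
  simp only [Module.finrank_prod]
  push_cast
  ring

/-- The map `β ↦ β (x ·, ·)` takes symmetric to alternating forms, and its kernel consists of forms
on the quotient `M / x M`. By assumption the class of `m` spans this quotient, as it does if `m`
generates `M` as a `k[x]`-module. -/
theorem formsIndex_le_of_cyclic (x : Module.End k M) (m : M)
    (hm : ∀ v, ∃ (c : k) (u : M), v = c • m + x u) :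
    formsIndex x ≤ Module.finrank k (LinearMap.ker x) := by
  let T : skewForms 1 x →ₗ[k] skewForms (-1) x :=
    { toFun := fun β => ⟨β.1.comap x LinearMap.id, fun v w => by
          have h1 := β.2.1 w (x v)
          have h2 := β.2.2 w v
          simp only [Pairing.comap_tmul, LinearMap.id_apply]
          linear_combination h2 + h1, fun v w => by simp [β.2.2]⟩
      map_add' := fun _ _ => rfl
      map_smul' := fun _ _ => rfl }
  have hT : ∀ β ∈ LinearMap.ker T, ∀ u w, β.1 (x u ⊗ₜ w) = 0 := fun β hβ u w =>
    DFunLike.congr_fun (congrArg Subtype.val hβ) (u ⊗ₜ w)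
  have hT' : ∀ β ∈ LinearMap.ker T, ∀ u w, β.1 (w ⊗ₜ x u) = 0 := fun β hβ u w => by
    rw [β.2.1 (x u) w, hT β hβ, mul_zero]
  have hker : Module.finrank k (LinearMap.ker T) ≤ Module.finrank k (LinearMap.ker x) := by
    rcases Nat.eq_zero_or_pos (Module.finrank k (LinearMap.ker x)) with h0 | h0
    · have hx : Function.Surjective x := LinearMap.surjective_of_injective
        (LinearMap.ker_eq_bot.1 (Submodule.finrank_eq_zero.1 h0))
      rw [h0, Nat.le_zero, Submodule.finrank_eq_zero, eq_bot_iff]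
      intro β hβ
      refine Subtype.ext (Pairing.ext_tmul fun v w => ?_)
      obtain ⟨u, rfl⟩ := hx v
      exact hT β hβ u w
    · let ev : LinearMap.ker T →ₗ[k] k :=
        { toFun := fun β => β.1.1 (m ⊗ₜ m)
          map_add' := fun _ _ => rfl
          map_smul' := fun _ _ => rfl }
      have hev : Function.Injective ev := by
        refine LinearMap.ker_eq_bot.1 (eq_bot_iff.2 fun β hβ => ?_)
        have h0 : β.1.1 (m ⊗ₜ m) = 0 := hβ
        refine Subtype.ext (Subtype.ext (Pairing.ext_tmul fun v w => ?_))
        obtain ⟨c, u, rfl⟩ := hm v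
        obtain ⟨d, u', rfl⟩ := hm w
        simp only [TensorProduct.add_tmul, TensorProduct.tmul_add, ← TensorProduct.smul_tmul',
          TensorProduct.tmul_smul, map_add, map_smul, hT β.1 β.2, hT' β.1 β.2, h0, smul_zero,
          add_zero]
        simp
      have := LinearMap.finrank_le_finrank_of_injective hev
      rw [Module.finrank_self] at this
      omega
  have h1 := LinearMap.finrank_range_add_finrank_ker T
  have h2 := Submodule.finrank_le (LinearMap.range T)
  rw [formsIndex]
  omega

end Forms

section Family

variable {k : Type*} [Field k]

/-- The endomorphism of a product that acts on each factor by the given one. -/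
def piEnd {ι : Type*} {N : ι → Type*} [∀ i, AddCommGroup (N i)] [∀ i, Module k (N i)]
    (x : ∀ i, Module.End k (N i)) : Module.End k (∀ i, N i) :=
  LinearMap.pi fun i => x i ∘ₗ LinearMap.proj i

theorem formsIndex_piEnd {ι : Type*} [Fintype ι] {N : ι → Type*} [∀ i, AddCommGroup (N i)]
    [∀ i, Module k (N i)] [∀ i, FiniteDimensional k (N i)] (x : ∀ i, Module.End k (N i)) :
    formsIndex (piEnd x) = ∑ i, formsIndex (x i) := by
  revert N
  refine Fintype.induction_empty_option (P := fun ι _ => ∀ {N : ι → Type _}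
    [∀ i, AddCommGroup (N i)] [∀ i, Module k (N i)] [∀ i, FiniteDimensional k (N i)]
    (x : ∀ i, Module.End k (N i)), formsIndex (piEnd x) = ∑ i, formsIndex (x i)) ?_ ?_ ?_ ι
  · intro α β _ e ih N _ _ _ x
    let _ := Fintype.ofEquiv β e.symm
    rw [← e.sum_comp, ← ih fun i => x (e i)]
    exact (formsIndex_congr _ _ (LinearEquiv.piCongrLeft k N e) fun v => by
      ext i
      obtain ⟨j, rfl⟩ := e.surjective i
      change Equiv.piCongrLeft N e _ (e j) = x (e j) (Equiv.piCongrLeft N e _ (e j))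
      rw [Equiv.piCongrLeft_apply_apply, Equiv.piCongrLeft_apply_apply]
      rfl).symm
  · intro N _ _ _ x
    have h (ε : k) : Module.finrank k (skewForms ε (piEnd x)) = 0 := by
      have : Subsingleton (skewForms ε (piEnd x)) :=
        ⟨fun a b => Subtype.ext (Pairing.ext_tmul fun v w => by
          rw [Subsingleton.elim v 0, TensorProduct.zero_tmul, map_zero, map_zero])⟩
      exact Module.finrank_zero_of_subsingleton
    simp [formsIndex, h]
  · intro α _ ih N _ _ _ x
    rw [Fintype.sum_option, ← ih fun i => x (some i), ← formsIndex_prodMap]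
    exact formsIndex_congr _ _ (LinearEquiv.piOptionEquivProd k) fun v => rfl

theorem finrank_ker_piEnd {ι : Type*} [Fintype ι] {N : ι → Type*} [∀ i, AddCommGroup (N i)]
    [∀ i, Module k (N i)] [∀ i, FiniteDimensional k (N i)] (x : ∀ i, Module.End k (N i)) :
    Module.finrank k (LinearMap.ker (piEnd x)) =
      ∑ i, Module.finrank k (LinearMap.ker (x i)) := by
  rw [← Module.finrank_pi_fintype]
  refine LinearEquiv.finrank_eq
    { toFun := fun v i => ⟨v.1 i, congrFun v.2 i⟩
      invFun := fun v => ⟨fun i => v i, funext fun i => (v i).2⟩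
      map_add' := fun _ _ => rfl
      map_smul' := fun _ _ => rfl
      left_inv := fun _ => rfl
      right_inv := fun _ => rfl }

/-- Both sides are additive, so the decomposition of `M` into cyclic modules over `k[X]` reduces
this to `formsIndex_le_of_cyclic`. -/
theorem formsIndex_le_finrank_ker {M : Type*} [AddCommGroup M] [Module k M] [FiniteDimensional k M]
    (x : Module.End k M) : formsIndex x ≤ Module.finrank k (LinearMap.ker x) := by
  classical
  obtain ⟨ι, _, p, hp, n, ⟨e⟩⟩ := Module.equiv_directSum_of_isTorsion
    (R := Polynomial k) (M := Module.AEval' x) (Module.AEval.isTorsion_of_finiteDimensional k M x)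
  let N : ι → Type _ := fun i => Polynomial k ⧸ Submodule.span (Polynomial k) {p i ^ n i}
  let y : ∀ i, Module.End k (N i) := fun i =>
    (LinearMap.lsmul (Polynomial k) (N i) Polynomial.X).restrictScalars k
  let e' : M ≃ₗ[k] ∀ i, N i := (Module.AEval'.of x) ≪≫ₗ
    (e ≪≫ₗ DirectSum.linearEquivFunOnFintype _ _ _).restrictScalars k
  have hN (i : ι) : FiniteDimensional k (N i) :=
    Module.Finite.of_surjective ((LinearMap.proj i : (∀ i, N i) →ₗ[k] N i) ∘ₗ e'.toLinearMap)
      ((Function.surjective_eval i).comp e'.surjective)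
  have he (v : M) : e' (x v) = piEnd y (e' v) := by
    have : Module.AEval'.of x (x v) = (Polynomial.X : Polynomial k) • Module.AEval'.of x v :=
      (Module.AEval'.X_smul_of x v).symm
    ext i
    simp only [e', LinearEquiv.trans_apply, this]
    simp [piEnd, y]
  have hk : Module.finrank k (LinearMap.ker x) = Module.finrank k (LinearMap.ker (piEnd y)) := by
    refine LinearEquiv.finrank_eq (LinearEquiv.ofSubmodules e' _ _ ?_)
    ext v
    rw [Submodule.mem_map_equiv, LinearMap.mem_ker, LinearMap.mem_ker, ← e'.map_eq_zero_iff, he,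
      e'.apply_symm_apply]
  rw [hk, formsIndex_congr x _ e' he, formsIndex_piEnd, finrank_ker_piEnd]
  push_cast
  refine Finset.sum_le_sum fun i _ => formsIndex_le_of_cyclic _ (Submodule.Quotient.mk 1) ?_
  intro v
  obtain ⟨f, rfl⟩ := Submodule.Quotient.mk_surjective _ v
  refine ⟨f.coeff 0, Submodule.Quotient.mk f.divX, ?_⟩
  change _ = _ + (Polynomial.X : Polynomial k) • Submodule.Quotient.mk f.divX
  rw [← Submodule.Quotient.mk_smul, ← Submodule.Quotient.mk_smul, ← Submodule.Quotient.mk_add]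
  congr 1
  conv_lhs => rw [← Polynomial.X_mul_divX_add f]
  rw [Polynomial.smul_eq_C_mul, mul_one, smul_eq_mul, add_comm]

theorem formsIndex_zero_pi (hk : (2 : k) ≠ 0) (ι : Type*) [Fintype ι] :
    formsIndex (0 : Module.End k (ι → k)) = Fintype.card ι := by
  have h1 : formsIndex (0 : Module.End k k) = 1 := by
    have hneg : Module.finrank k (skewForms (-1 : k) (0 : Module.End k k)) = 0 := by
      rw [Submodule.finrank_eq_zero, eq_bot_iff]
      rintro β ⟨hβ, -⟩
      have h0 : β (1 ⊗ₜ 1) = 0 := by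
        have : 2 * β (1 ⊗ₜ 1) = 0 := by linear_combination hβ 1 1
        exact (mul_eq_zero.1 this).resolve_left hk
      refine Pairing.ext_tmul fun v w => ?_
      rw [← mul_one v, ← mul_one w, ← smul_eq_mul, ← smul_eq_mul, TensorProduct.smul_tmul_smul,
        map_smul, h0]
      simp
    have hpos : Module.finrank k (skewForms (1 : k) (0 : Module.End k k)) = 1 := by
      let B : Pairing k k k := LinearMap.mul' k k
      have hB (v w : k) : B (v ⊗ₜ w) = v * w := rfl
      rw [finrank_eq_one_iff']
      refine ⟨⟨B, fun v w => by rw [hB, hB, one_mul, mul_comm], fun v w => by simp⟩, ?_, ?_⟩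
      · intro h
        have h1 : B (1 ⊗ₜ 1) = 0 := DFunLike.congr_fun (congrArg Subtype.val h) (1 ⊗ₜ 1)
        rw [hB, one_mul] at h1
        exact one_ne_zero h1
      · rintro ⟨β, hβ⟩
        refine ⟨β (1 ⊗ₜ 1), Subtype.ext (Pairing.ext_tmul fun v w => ?_)⟩
        change β (1 ⊗ₜ 1) * (v * w) = _
        conv_rhs => rw [← mul_one v, ← mul_one w, ← smul_eq_mul, ← smul_eq_mul,
          TensorProduct.smul_tmul_smul, map_smul, smul_eq_mul]
        ring
    rw [formsIndex, hneg, hpos]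
    simp
  have := formsIndex_piEnd (k := k) (ι := ι) (N := fun _ => k) fun _ => 0
  simp only [h1, Finset.sum_const, Finset.card_univ, nsmul_eq_mul, mul_one] at this
  rw [← this]
  congr 1

end Family

/-! ### Dimensions of centralizers in symmetric and in skew-symmetric matrices -/

section Matrix

variable {k : Type*} [Field k] {n : Type*} [Fintype n] [DecidableEq n]

/-- The matrices `A` with `Aᵀ = ε A` which commute with `X`. -/
def signedCentralizer (ε : k) (X : Matrix n n k) : Submodule k (Matrix n n k) where
  carrier := {A | A.transpose = ε • A ∧ X * A = A * X}
  zero_mem' := by simp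
  add_mem' := by
    rintro a b ⟨ha, ha'⟩ ⟨hb, hb'⟩
    exact ⟨by rw [Matrix.transpose_add, ha, hb, smul_add], by rw [mul_add, add_mul, ha', hb']⟩
  smul_mem' := by
    rintro c a ⟨ha, ha'⟩
    exact ⟨by rw [Matrix.transpose_smul, ha, smul_comm], by
      rw [Matrix.mul_smul, Matrix.smul_mul, ha']⟩

theorem mem_signedCentralizer {ε : k} {X A : Matrix n n k} :
    A ∈ signedCentralizer ε X ↔ A.transpose = ε • A ∧ X * A = A * X := Iff.rfl

/-- A matrix `A` corresponds to the form with Gram matrix `A`. -/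
theorem finrank_signedCentralizer (ε : k) (X : Matrix n n k) (hX : X.transpose = -X) :
    Module.finrank k (signedCentralizer ε X) =
      Module.finrank k (skewForms ε (Matrix.toLin' X)) := by
  let E : Matrix n n k ≃ₗ[k] Pairing k (n → k) (n → k) :=
    Matrix.toBilin' ≪≫ₗ TensorProduct.lift.equiv (RingHom.id k) (n → k) (n → k) k
  have hE (A : Matrix n n k) (v w : n → k) : E A (v ⊗ₜ w) = v ⬝ᵥ A.mulVec w :=
    Matrix.toBilin'_apply' A v w
  refine LinearEquiv.finrank_eq (LinearEquiv.ofSubmodules E _ _ ?_)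
  ext β
  rw [Submodule.mem_map_equiv]
  obtain ⟨A, rfl⟩ := E.surjective β
  rw [LinearEquiv.symm_apply_apply]
  have h1 : A.transpose = ε • A ↔ ∀ v w, E A (w ⊗ₜ v) = ε * E A (v ⊗ₜ w) := by
    rw [← E.injective.eq_iff]
    refine ⟨fun h v w => ?_, fun h => Pairing.ext_tmul fun v w => ?_⟩
    · have := DFunLike.congr_fun h (v ⊗ₜ w)
      rw [map_smul, Pairing.smul_apply, hE, Matrix.mulVec_transpose,
        dotProduct_comm, ← Matrix.dotProduct_mulVec, ← hE] at this
      exact this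
    · rw [map_smul, Pairing.smul_apply, ← h v w, hE, hE, Matrix.mulVec_transpose,
        dotProduct_comm, ← Matrix.dotProduct_mulVec]
  have h2 : X * A = A * X ↔ ∀ v w, E A (Matrix.toLin' X v ⊗ₜ w) =
      -E A (v ⊗ₜ Matrix.toLin' X w) := by
    have h3 (v w) : E A (Matrix.toLin' X v ⊗ₜ w) = -E (X * A) (v ⊗ₜ w) := by
      rw [hE, hE, Matrix.toLin'_apply, ← Matrix.mulVec_mulVec, Matrix.dotProduct_mulVec v,
        ← Matrix.mulVec_transpose, hX, Matrix.neg_mulVec, neg_dotProduct, neg_neg]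
    have h4 (v w) : E A (v ⊗ₜ Matrix.toLin' X w) = E (A * X) (v ⊗ₜ w) := by
      rw [hE, hE, Matrix.toLin'_apply, Matrix.mulVec_mulVec]
    simp only [h3, h4, neg_inj]
    rw [← E.injective.eq_iff]
    exact ⟨fun h v w => by rw [h], fun h => Pairing.ext_tmul h⟩
  exact and_congr h1 h2

/-- The dimension of the space of symmetric matrices exceeds that of skew-symmetric ones by the
size of the matrices. -/
theorem finrank_signedCentralizer_zero (hk : (2 : k) ≠ 0) :
    Module.finrank k (signedCentralizer (1 : k) (0 : Matrix n n k)) =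
      Module.finrank k (signedCentralizer (-1 : k) (0 : Matrix n n k)) + Fintype.card n := by
  have := formsIndex_zero_pi hk n
  rw [finrank_signedCentralizer _ _ (by simp), finrank_signedCentralizer _ _ (by simp), map_zero]
  rw [formsIndex] at this
  omega

theorem finrank_signedCentralizer_le (X : Matrix n n k) (hX : X.transpose = -X) :
    Module.finrank k (signedCentralizer (1 : k) X) + X.rank ≤
      Module.finrank k (signedCentralizer (-1 : k) X) + Fintype.card n := by
  have := formsIndex_le_finrank_ker (Matrix.toLin' X)
  rw [finrank_signedCentralizer _ _ hX, finrank_signedCentralizer _ _ hX]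
  have h := LinearMap.finrank_range_add_finrank_ker (Matrix.toLin' X)
  rw [Module.finrank_fintype_fun_eq_card] at h
  have hr : X.rank = Module.finrank k (LinearMap.range (Matrix.toLin' X)) := rfl
  rw [formsIndex] at this
  omega

end Matrix

/-! ### The Cayley transform -/

section Cayley

variable {B : Type*} [CommRing B] {n : Type*} [Fintype n] [DecidableEq n]

/-- The Cayley transform `(1 - u) (1 + u)⁻¹`; it is meaningful if `1 + u` is invertible. -/
def cayley (u : Matrix n n B) : Matrix n n B := (1 - u) * (1 + u)⁻¹

theorem one_add_cayley {u : Matrix n n B} (hu : IsUnit (1 + u).det) :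
    1 + cayley u = 2 * (1 + u)⁻¹ := by
  calc 1 + cayley u = (1 + u) * (1 + u)⁻¹ + (1 - u) * (1 + u)⁻¹ := by
        rw [Matrix.mul_nonsing_inv _ hu, cayley]
    _ = 2 * (1 + u)⁻¹ := by rw [← add_mul]; congr 1; rw [← one_add_one_eq_two]; abel

theorem isUnit_det_two (h2 : IsUnit (2 : B)) : IsUnit (2 : Matrix n n B).det := by
  have : (2 : Matrix n n B) = (2 : B) • (1 : Matrix n n B) := by
    rw [ofNat_smul_eq_nsmul, nsmul_one]; rfl
  rw [this, Matrix.det_smul, Matrix.det_one, mul_one]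
  exact h2.pow _

theorem isUnit_det_one_add_cayley (h2 : IsUnit (2 : B)) {u : Matrix n n B}
    (hu : IsUnit (1 + u).det) : IsUnit (1 + cayley u).det := by
  rw [one_add_cayley hu, Matrix.det_mul]
  exact (isUnit_det_two h2).mul ((Matrix.isUnit_nonsing_inv_det_iff).2 hu)

theorem cayley_cayley (h2 : IsUnit (2 : B)) {u : Matrix n n B} (hu : IsUnit (1 + u).det) :
    cayley (cayley u) = u := by
  have h := isUnit_det_one_add_cayley h2 hu
  have h1 : u * (1 + cayley u) = 1 - cayley u := by
    have e : u * (2 * (1 + u)⁻¹) = ((1 + u) - (1 - u)) * (1 + u)⁻¹ := by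
      rw [← mul_assoc]
      congr 1
      rw [← one_add_one_eq_two, mul_add, mul_one]
      abel
    rw [one_add_cayley hu, e, sub_mul, Matrix.mul_nonsing_inv _ hu, cayley]
  rw [cayley, ← h1, mul_assoc, Matrix.mul_nonsing_inv _ h, mul_one]

theorem cayley_transpose_mul_self {u : Matrix n n B} (hu : IsUnit (1 + u).det)
    (hs : u.transpose = -u) : (cayley u).transpose * cayley u = 1 := by
  have hu' : IsUnit (1 - u).det := by
    have hu := Matrix.isUnit_det_transpose _ hu
    rwa [Matrix.transpose_add, Matrix.transpose_one, hs, ← sub_eq_add_neg] at hu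
  rw [cayley, Matrix.transpose_mul, Matrix.transpose_nonsing_inv, Matrix.transpose_sub,
    Matrix.transpose_add, Matrix.transpose_one, hs, sub_neg_eq_add, ← sub_eq_add_neg]
  calc (1 - u)⁻¹ * (1 + u) * ((1 - u) * (1 + u)⁻¹)
      = (1 - u)⁻¹ * ((1 + u) * (1 - u)) * (1 + u)⁻¹ := by noncomm_ring
    _ = (1 - u)⁻¹ * ((1 - u) * (1 + u)) * (1 + u)⁻¹ := by
        congr 2; noncomm_ring
    _ = ((1 - u)⁻¹ * (1 - u)) * ((1 + u) * (1 + u)⁻¹) := by noncomm_ring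
    _ = 1 := by rw [Matrix.mul_nonsing_inv _ hu, Matrix.nonsing_inv_mul _ hu', one_mul]

theorem cayley_transpose {g : Matrix n n B} (hg : IsUnit (1 + g).det)
    (ho : g.transpose * g = 1) : (cayley g).transpose = -cayley g := by
  have hg' : IsUnit (1 + g.transpose).det := by
    have hg := Matrix.isUnit_det_transpose _ hg
    rwa [Matrix.transpose_add, Matrix.transpose_one] at hg
  rw [cayley, Matrix.transpose_mul, Matrix.transpose_nonsing_inv, Matrix.transpose_sub,
    Matrix.transpose_add, Matrix.transpose_one]
  have key : (1 - g.transpose) * (1 + g) = -((1 + g.transpose) * (1 - g)) := by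
    have e1 : (1 - g.transpose) * (1 + g) = 1 + g - g.transpose - g.transpose * g := by
      noncomm_ring
    have e2 : (1 + g.transpose) * (1 - g) = 1 - g + g.transpose - g.transpose * g := by
      noncomm_ring
    rw [e1, e2, ho]
    abel
  calc (1 + g.transpose)⁻¹ * (1 - g.transpose)
      = (1 + g.transpose)⁻¹ * ((1 - g.transpose) * (1 + g)) * (1 + g)⁻¹ := by
        rw [mul_assoc, mul_assoc, Matrix.mul_nonsing_inv _ hg, mul_one]
    _ = -((1 + g.transpose)⁻¹ * (1 + g.transpose) * ((1 - g) * (1 + g)⁻¹)) := by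
        rw [key]; noncomm_ring
    _ = -((1 - g) * (1 + g)⁻¹) := by rw [Matrix.nonsing_inv_mul _ hg', one_mul]

theorem map_nonsing_inv' {B' : Type*} [CommRing B'] (f : B →+* B') {A : Matrix n n B}
    (hA : IsUnit A.det) : f.mapMatrix A⁻¹ = (f.mapMatrix A)⁻¹ := by
  refine (Matrix.inv_eq_left_inv ?_).symm
  rw [← map_mul, Matrix.nonsing_inv_mul _ hA, map_one]

theorem map_cayley {B' : Type*} [CommRing B'] (f : B →+* B') {u : Matrix n n B}
    (hu : IsUnit (1 + u).det) : f.mapMatrix (cayley u) = cayley (f.mapMatrix u) := by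
  rw [cayley, map_mul, map_nonsing_inv' f hu, map_sub, map_add, map_one, cayley]

theorem cayley_mul_comm {u x : Matrix n n B} (hu : IsUnit (1 + u).det) (h : u * x = x * u) :
    cayley u * x = x * cayley u := by
  have h1 : (1 + u) * x = x * (1 + u) := by rw [add_mul, mul_add, h, one_mul, mul_one]
  have h2 : (1 - u) * x = x * (1 - u) := by rw [sub_mul, mul_sub, h, one_mul, mul_one]
  have h3 : (1 + u)⁻¹ * x = x * (1 + u)⁻¹ := by
    calc (1 + u)⁻¹ * x = (1 + u)⁻¹ * (x * (1 + u)) * (1 + u)⁻¹ := by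
          rw [mul_assoc, mul_assoc, Matrix.mul_nonsing_inv _ hu, mul_one]
      _ = x * (1 + u)⁻¹ := by
          rw [← h1, ← mul_assoc, Matrix.nonsing_inv_mul _ hu, one_mul]
  rw [cayley, mul_assoc, h3, ← mul_assoc, h2, mul_assoc]

end Cayley

/-! ### Orthogonal matrices up to signs are Cayley transforms -/

section Signs

variable {k : Type*} [Field k] {n : Type*} [Fintype n] [DecidableEq n]

/-- The sign `1` or `-1` given by a Boolean. -/
def boolSign (k : Type*) [Field k] (s : Bool) : k := if s then 1 else -1

theorem boolSign_mul_self (s : Bool) : boolSign k s * boolSign k s = 1 := by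
  cases s <;> simp [boolSign]

/-- The determinant of `diagonal d + g` is affine in each `d i`, so it vanishes identically if it
vanishes for all choices of signs. -/
theorem exists_sign_det_ne_zero [Infinite k] (h2 : (2 : k) ≠ 0) (g : Matrix n n k) :
    ∃ s : n → Bool, (Matrix.diagonal (fun i => boolSign k (s i)) + g).det ≠ 0 := by
  by_contra! hall
  let f : (n → k) → k := fun d => (Matrix.diagonal d + g).det
  have haff (d : n → k) (i : n) : ∃ α β : k, ∀ a, f (Function.update d i a) = α + a * β := by
    let A := Matrix.diagonal (Function.update d i 0) + g
    refine ⟨A.det, (A.updateRow i (Pi.single i 1)).det, fun a => ?_⟩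
    have : Matrix.diagonal (Function.update d i a) + g =
        A.updateRow i (A i + a • Pi.single i 1) := by
      ext p q
      by_cases hp : p = i
      · subst hp
        by_cases hq : q = p
        · subst hq; simp [A, add_comm]
        · simp [A, hq, Matrix.diagonal_apply_ne _ (Ne.symm hq)]
      · simp [A, hp, Matrix.diagonal_apply]
    change (Matrix.diagonal (Function.update d i a) + g).det = _
    rw [this, Matrix.det_updateRow_add, Matrix.det_updateRow_smul, Matrix.updateRow_eq_self]
  -- By induction on the number of coordinates that are not signs.
  have hzero (T : Finset n) : ∀ d : n → k, (∀ j ∉ T, ∃ s, d j = boolSign k s) → f d = 0 := by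
    induction T using Finset.induction_on with
    | empty =>
      intro d hd
      choose s hs using fun j => hd j (Finset.notMem_empty j)
      rw [show d = fun i => boolSign k (s i) from funext hs]
      exact hall s
    | insert i T _ ih =>
      intro d hd
      obtain ⟨α, β, h⟩ := haff d i
      have hs (s : Bool) : α + boolSign k s * β = 0 := by
        rw [← h]
        refine ih _ fun j hj => ?_
        by_cases hji : j = i
        · subst hji; exact ⟨s, by simp⟩
        · rw [Function.update_of_ne hji]
          exact hd j (by simp [hji, hj])
      have ht := hs true
      have hf := hs false
      simp only [boolSign, if_true, Bool.false_eq_true, if_false] at ht hf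
      have hα : α = 0 := (mul_eq_zero.1 (by linear_combination ht + hf : 2 * α = 0)).resolve_left h2
      have hβ : β = 0 := by linear_combination ht - hα
      have := h (d i)
      rw [Function.update_eq_self, hα, hβ] at this
      simpa using this
  -- So `det (c + g)` vanishes for all scalars `c`, but it is a characteristic polynomial in `c`.
  have hchar : (-g).charpoly = 0 := by
    refine Polynomial.funext fun c => ?_
    rw [Matrix.eval_charpoly, Polynomial.eval_zero, sub_neg_eq_add]
    exact hzero Finset.univ (fun _ => c) (fun j hj => absurd (Finset.mem_univ j) hj)
  exact (Matrix.charpoly_monic (-g)).ne_zero hchar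

theorem exists_eq_sign_mul_cayley [Infinite k] (h2 : (2 : k) ≠ 0) {g : Matrix n n k}
    (hg : g.transpose * g = 1) : ∃ (s : n → Bool) (u : Matrix n n k), u.transpose = -u ∧
      IsUnit (1 + u).det ∧ g = Matrix.diagonal (fun i => boolSign k (s i)) * cayley u := by
  obtain ⟨s, hs⟩ := exists_sign_det_ne_zero h2 g
  let D := Matrix.diagonal fun i => boolSign k (s i)
  have hD : D * D = 1 := by
    simp only [D, Matrix.diagonal_mul_diagonal, boolSign_mul_self, Matrix.diagonal_one]
  have hDt : D.transpose = D := Matrix.diagonal_transpose _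
  have hdet : IsUnit (1 + D * g).det := by
    have : D + g = D * (1 + D * g) := by rw [mul_add, mul_one, ← mul_assoc, hD, one_mul]
    have h' : (D + g).det ≠ 0 := hs
    rw [this, Matrix.det_mul] at h'
    exact (right_ne_zero_of_mul h').isUnit
  have h2u : IsUnit (2 : k) := h2.isUnit
  refine ⟨s, cayley (D * g), cayley_transpose hdet ?_, isUnit_det_one_add_cayley h2u hdet, ?_⟩
  · rw [Matrix.transpose_mul, hDt, mul_assoc, ← mul_assoc D, hD, one_mul, hg]
  · rw [cayley_cayley h2u hdet, ← mul_assoc]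
    change g = D * D * g
    rw [hD, one_mul]

end Signs

/-! ### The lowest homogeneous component along a formal arc -/

section Arc

variable {k : Type*} [Field k] {τ : Type*}

theorem aeval_mul_of_isHomogeneous {B : Type*} [CommRing B] [Algebra k B] {p : MvPolynomial τ k}
    {j : ℕ} (hp : p.IsHomogeneous j) (c : B) (N : τ → B) :
    MvPolynomial.aeval (fun i => c * N i) p = c ^ j * MvPolynomial.aeval N p := by
  rw [MvPolynomial.aeval_def, MvPolynomial.aeval_def, MvPolynomial.eval₂_eq,
    MvPolynomial.eval₂_eq, Finset.mul_sum]
  refine Finset.sum_congr rfl fun d hd => ?_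
  have := hp (MvPolynomial.mem_support_iff.1 hd)
  have hdeg : ∑ i ∈ d.support, d i = j := by
    rw [← this, Finsupp.weight_apply, Finsupp.sum]
    simp
  simp only [mul_pow, Finset.prod_mul_distrib, Finset.prod_pow_eq_pow_sum, hdeg]
  ring

/-- The witness `v` is a point where the lowest homogeneous component of `r` does not vanish. -/
theorem exists_forall_aeval_X_mul_ne_zero [Infinite k] {r : MvPolynomial τ k} (hr : r ≠ 0) :
    ∃ v : τ → k, ∀ N : τ → PowerSeries k, (∀ i, PowerSeries.constantCoeff (N i) = v i) →
      MvPolynomial.aeval (fun i => PowerSeries.X * N i) r ≠ 0 := by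
  classical
  have hex : ∃ j, MvPolynomial.homogeneousComponent j r ≠ 0 := by
    by_contra! h
    apply hr
    rw [← MvPolynomial.sum_homogeneousComponent r]
    exact Finset.sum_eq_zero fun i _ => h i
  let e := Nat.find hex
  have he : MvPolynomial.homogeneousComponent e r ≠ 0 := Nat.find_spec hex
  obtain ⟨v, hv⟩ : ∃ v, MvPolynomial.eval v (MvPolynomial.homogeneousComponent e r) ≠ 0 := by
    by_contra! h
    exact he (MvPolynomial.funext fun v => by rw [h, map_zero])
  refine ⟨v, fun N hN h0 => ?_⟩
  have hc := congrArg (PowerSeries.coeff e) h0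
  rw [← MvPolynomial.sum_homogeneousComponent r, map_sum, map_sum, map_zero] at hc
  have hterm (j : ℕ) : PowerSeries.coeff e (MvPolynomial.aeval (fun i => PowerSeries.X * N i)
      (MvPolynomial.homogeneousComponent j r)) =
      if j = e then MvPolynomial.eval v (MvPolynomial.homogeneousComponent e r) else 0 := by
    rw [aeval_mul_of_isHomogeneous (MvPolynomial.homogeneousComponent_isHomogeneous j r),
      PowerSeries.coeff_X_pow_mul']
    rcases lt_trichotomy j e with hj | rfl | hj
    · have : MvPolynomial.homogeneousComponent j r = 0 := not_not.1 (Nat.find_min hex hj)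
      rw [this, map_zero, map_zero, ite_self, if_neg hj.ne]
    · rw [if_pos le_rfl, if_pos rfl, Nat.sub_self, PowerSeries.coeff_zero_eq_constantCoeff_apply]
      have h1 : (PowerSeries.constantCoeff (R := k)).comp (algebraMap k (PowerSeries k)) =
          RingHom.id k := by
        ext c; simp
      rw [MvPolynomial.aeval_def, MvPolynomial.hom_eval₂, h1, funext hN]
      rfl
    · rw [if_neg hj.not_ge, if_neg hj.ne']
  simp only [hterm] at hc
  rw [Finset.sum_ite_eq' , if_pos] at hc
  · exact hv hc
  · rw [Finset.mem_range, Nat.lt_succ_iff]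
    by_contra! hlt
    exact he (MvPolynomial.homogeneousComponent_eq_zero _ _ hlt)

end Arc

/-! ### The dimension of an orbit of skew-symmetric matrices -/

section Orbit

universe u

variable {k : Type u} [Field k] {n : Type*} [Fintype n] [DecidableEq n] {τ : Type*} [Fintype τ]

/-- The linear combination of the matrices `κ i` with coefficients `u i` in a `k`-algebra. -/
def combMatrix {B : Type*} [CommRing B] [Algebra k B] (κ : τ → Matrix n n k) (u : τ → B) :
    Matrix n n B := ∑ i, u i • (algebraMap k B).mapMatrix (κ i)

theorem map_combMatrix {B B' : Type*} [CommRing B] [Algebra k B] [CommRing B'] [Algebra k B']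
    (f : B →ₐ[k] B') (κ : τ → Matrix n n k) (u : τ → B) :
    (f : B →+* B').mapMatrix (combMatrix κ u) = combMatrix κ fun i => f (u i) := by
  ext i j
  simp [combMatrix, Matrix.sum_apply]

/-- Substitution of the point `g · x · gᵀ` of the orbit of `x`, where `g = D · cayley u` for the
matrix `u` with coordinates `u i` with respect to the matrices `κ i`. -/
def orbitEval {B : Type*} [CommRing B] [Algebra k B] (D x : Matrix n n k) (κ : τ → Matrix n n k)
    (u : τ → B) : MvPolynomial (n × n) k →ₐ[k] B :=
  MvPolynomial.aeval fun p => ((algebraMap k B).mapMatrix D * (cayley (combMatrix κ u) *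
    (algebraMap k B).mapMatrix x * (cayley (combMatrix κ u)).transpose) *
      ((algebraMap k B).mapMatrix D).transpose) p.1 p.2

theorem comp_orbitEval {B B' : Type*} [CommRing B] [Algebra k B] [CommRing B'] [Algebra k B']
    (f : B →ₐ[k] B') (D x : Matrix n n k) (κ : τ → Matrix n n k) (u : τ → B)
    (hu : IsUnit (1 + combMatrix κ u).det) :
    f.comp (orbitEval D x κ u) = orbitEval D x κ fun i => f (u i) := by
  refine MvPolynomial.algHom_ext fun p => ?_
  have hf (A : Matrix n n k) : (f : B →+* B').mapMatrix ((algebraMap k B).mapMatrix A) =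
      (algebraMap k B').mapMatrix A := by
    ext i j; simp
  have hc : (f : B →+* B').mapMatrix (cayley (combMatrix κ u)) =
      cayley (combMatrix κ fun i => f (u i)) := by
    rw [map_cayley _ hu, map_combMatrix]
  have ht (A : Matrix n n B) : (f : B →+* B').mapMatrix A.transpose =
      ((f : B →+* B').mapMatrix A).transpose := rfl
  rw [AlgHom.comp_apply, orbitEval, orbitEval, MvPolynomial.aeval_X, MvPolynomial.aeval_X]
  rw [← hc, ← hf x, ← hf D, ← ht, ← ht, ← map_mul, ← map_mul, ← map_mul, ← map_mul]
  rfl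

/-- The denominator of the Cayley transform of the generic linear combination of the `κ i`. -/
def genericDet (κ : τ → Matrix n n k) : MvPolynomial τ k :=
  (1 + combMatrix κ (MvPolynomial.X : τ → MvPolynomial τ k)).det

theorem aeval_genericDet {B : Type*} [CommRing B] [Algebra k B] (κ : τ → Matrix n n k)
    (u : τ → B) : MvPolynomial.aeval u (genericDet κ) = (1 + combMatrix κ u).det := by
  have h := map_combMatrix (MvPolynomial.aeval u : MvPolynomial τ k →ₐ[k] B) κ MvPolynomial.X
  have h' := RingHom.map_det ((MvPolynomial.aeval u : MvPolynomial τ k →ₐ[k] B) :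
    MvPolynomial τ k →+* B) (1 + combMatrix κ MvPolynomial.X)
  rw [map_add, map_one, h] at h'
  simpa [genericDet] using h'

theorem genericDet_ne_zero (κ : τ → Matrix n n k) : genericDet κ ≠ 0 := by
  intro h
  have := aeval_genericDet κ (0 : τ → k)
  rw [h, map_zero] at this
  simp [combMatrix] at this

/-- The coordinate ring of the open set of linear combinations of the `κ i` whose Cayley transform
is defined. -/
abbrev CayleyRing (κ : τ → Matrix n n k) : Type _ := Localization.Away (genericDet κ)

instance (κ : τ → Matrix n n k) : IsDomain (CayleyRing κ) :=
  IsLocalization.isDomain_localization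
    (powers_le_nonZeroDivisors_of_noZeroDivisors (genericDet_ne_zero κ))

/-- Substitution of the generic point `g x gᵀ`, where `g = D · cayley u` for the generic combination
`u` of the `κ i`. Over an infinite field, the kernel is the ideal of the set of all these points. -/
def genericOrbitEval (D x : Matrix n n k) (κ : τ → Matrix n n k) :
    MvPolynomial (n × n) k →ₐ[k] CayleyRing κ :=
  orbitEval D x κ fun i => algebraMap (MvPolynomial τ k) (CayleyRing κ) (MvPolynomial.X i)

theorem exists_specialization {B : Type*} [CommRing B] [Algebra k B] (D x : Matrix n n k)
    (κ : τ → Matrix n n k) (u : τ → B) (hu : IsUnit (1 + combMatrix κ u).det) :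
    ∃ φ : CayleyRing κ →ₐ[k] B,
      (∀ r, φ (algebraMap (MvPolynomial τ k) _ r) = MvPolynomial.aeval u r) ∧
      φ.comp (genericOrbitEval D x κ) = orbitEval D x κ u := by
  have hunit : ∀ y : Submonoid.powers (genericDet κ), IsUnit (MvPolynomial.aeval u y.1 : B) := by
    rintro ⟨_, m, rfl⟩
    simp only [map_pow, aeval_genericDet]
    exact hu.pow m
  let φ : CayleyRing κ →ₐ[k] B :=
    IsLocalization.liftAlgHom (M := Submonoid.powers (genericDet κ)) (f := MvPolynomial.aeval u)
      hunit
  have hφ (r) : φ (algebraMap _ _ r) = MvPolynomial.aeval u r :=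
    IsLocalization.lift_eq (M := Submonoid.powers (genericDet κ)) hunit r
  refine ⟨φ, hφ, ?_⟩
  rw [genericOrbitEval, comp_orbitEval]
  · simp only [hφ, MvPolynomial.aeval_X]
  · have h1 := aeval_genericDet κ fun i =>
      algebraMap (MvPolynomial τ k) (CayleyRing κ) (MvPolynomial.X i)
    rw [← h1]
    have h2 : MvPolynomial.aeval (fun i => algebraMap (MvPolynomial τ k) (CayleyRing κ)
        (MvPolynomial.X i)) (genericDet κ) = algebraMap _ (CayleyRing κ) (genericDet κ) := by
      have : MvPolynomial.aeval (fun i => algebraMap (MvPolynomial τ k) (CayleyRing κ)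
        (MvPolynomial.X i)) = IsScalarTower.toAlgHom k (MvPolynomial τ k) (CayleyRing κ) :=
        MvPolynomial.algHom_ext fun i => by simp
      rw [this]; rfl
    rw [h2]
    exact IsLocalization.Away.algebraMap_isUnit _

open PowerSeries in
theorem isUnit_det_of_constantCoeff {A : Matrix n n (PowerSeries k)}
    (h : IsUnit ((constantCoeff (R := k)).mapMatrix A).det) : IsUnit A.det := by
  rw [isUnit_iff_constantCoeff, RingHom.map_det]
  exact h

open PowerSeries in
/-- The arc `t ↦ t • M` lifts, through the Cayley transform, the product of the arcs `t • z` and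
`t • y`. Its tangent direction at `t = 0` is `z + y`, while it moves `x` in the same way as
`t • z`, since `y` commutes with `x`. -/
theorem exists_arc (h2 : (2 : k) ≠ 0) {x y z : Matrix n n k} (hz : z.transpose = -z)
    (hy : y.transpose = -y) (hyx : y * x = x * y) :
    ∃ M : Matrix n n (PowerSeries k), M.transpose = -M ∧
      (constantCoeff (R := k)).mapMatrix M = z + y ∧
      IsUnit (1 + (X : PowerSeries k) • M).det ∧
      IsUnit (1 + (X : PowerSeries k) • (algebraMap k (PowerSeries k)).mapMatrix z).det ∧
      cayley ((X : PowerSeries k) • M) * (algebraMap k (PowerSeries k)).mapMatrix x *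
        (cayley ((X : PowerSeries k) • M)).transpose =
      cayley ((X : PowerSeries k) • (algebraMap k (PowerSeries k)).mapMatrix z) *
        (algebraMap k (PowerSeries k)).mapMatrix x *
        (cayley ((X : PowerSeries k) • (algebraMap k (PowerSeries k)).mapMatrix z)).transpose := by
  let ι := (algebraMap k (PowerSeries k)).mapMatrix (m := n)
  let cst := (constantCoeff (R := k)).mapMatrix (m := n)
  have hcι (A : Matrix n n k) : cst (ι A) = A := by ext i j; simp [cst, ι]
  have hcX (A : Matrix n n (PowerSeries k)) : cst ((X : PowerSeries k) • A) = 0 := by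
    ext i j; simp [cst]
  have hιt (A : Matrix n n k) : (ι A).transpose = ι A.transpose := rfl
  have hunit (A : Matrix n n (PowerSeries k)) : IsUnit (1 + (X : PowerSeries k) • A).det := by
    apply isUnit_det_of_constantCoeff
    change IsUnit (cst _).det
    rw [map_add, hcX, map_one, add_zero, Matrix.det_one]
    exact isUnit_one
  have h2u : IsUnit (2 : PowerSeries k) := by
    rw [isUnit_iff_constantCoeff, map_ofNat]
    exact h2.isUnit
  have hcay (A : Matrix n n (PowerSeries k)) : cayley ((X : PowerSeries k) • A) =
      1 - (X : PowerSeries k) • (2 * (A * (1 + (X : PowerSeries k) • A)⁻¹)) := by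
    have h := Matrix.mul_nonsing_inv _ (hunit A)
    have e : (1 : Matrix n n (PowerSeries k)) - (X : PowerSeries k) • A =
        (1 + (X : PowerSeries k) • A) - (X : PowerSeries k) • (2 * A) := by
      rw [← one_add_one_eq_two, add_mul, one_mul, smul_add]; abel
    rw [cayley, e, sub_mul, h, Matrix.smul_mul, mul_assoc]
  have hskew (A : Matrix n n k) (hA : A.transpose = -A) :
      ((X : PowerSeries k) • ι A).transpose = -((X : PowerSeries k) • ι A) := by
    rw [Matrix.transpose_smul, hιt, hA, map_neg, smul_neg]
  let P := ι z * (1 + (X : PowerSeries k) • ι z)⁻¹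
  let Q := ι y * (1 + (X : PowerSeries k) • ι y)⁻¹
  have hP : cst P = z := by
    rw [map_mul, map_nonsing_inv' _ (hunit _)]
    change cst (ι z) * (cst _)⁻¹ = z
    rw [map_add, hcX, hcι, map_one, add_zero, inv_one, mul_one]
  have hQ : cst Q = y := by
    rw [map_mul, map_nonsing_inv' _ (hunit _)]
    change cst (ι y) * (cst _)⁻¹ = y
    rw [map_add, hcX, hcι, map_one, add_zero, inv_one, mul_one]
  let g := cayley ((X : PowerSeries k) • ι z) * cayley ((X : PowerSeries k) • ι y)
  -- `g` is `1` to order zero, so its Cayley transform is divisible by the parameter of the arc.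
  let g₁ := -(2 * P) - 2 * Q + (X : PowerSeries k) • (2 * P * (2 * Q))
  have hg : g = 1 + (X : PowerSeries k) • g₁ := by
    change cayley _ * cayley _ = _
    rw [hcay, hcay, sub_mul, one_mul, mul_sub, mul_one, smul_add, smul_sub, smul_neg,
      Matrix.smul_mul, Matrix.mul_smul]
    abel
  have hcg : cst g = 1 := by rw [hg, map_add, hcX, map_one, add_zero]
  have hgo : g.transpose * g = 1 := by
    have h1 := cayley_transpose_mul_self (hunit (ι z)) (hskew z hz)
    have h2 := cayley_transpose_mul_self (hunit (ι y)) (hskew y hy)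
    have hgd : g = cayley ((X : PowerSeries k) • ι z) * cayley ((X : PowerSeries k) • ι y) := rfl
    rw [hgd, Matrix.transpose_mul, mul_assoc, ← mul_assoc _ _ (cayley ((X : PowerSeries k) • ι y)),
      h1, one_mul, h2]
  have hg1 : IsUnit (1 + g).det := by
    apply isUnit_det_of_constantCoeff
    change IsUnit (cst _).det
    rw [map_add, hcg, map_one, one_add_one_eq_two]
    exact isUnit_det_two h2.isUnit
  let M := -g₁ * (1 + g)⁻¹
  have hM : (X : PowerSeries k) • M = cayley g := by
    have : 1 - g = (X : PowerSeries k) • -g₁ := by rw [hg, smul_neg]; abel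
    rw [cayley, this, Matrix.smul_mul]
  refine ⟨M, ?_, ?_, hunit M, hunit (ι z), ?_⟩
  · have h := cayley_transpose hg1 hgo
    rw [← hM, Matrix.transpose_smul, ← smul_neg] at h
    ext i j
    have := congrFun (congrFun h i) j
    simp only [Matrix.smul_apply, smul_eq_mul] at this
    exact congrArg _ (mul_left_cancel₀ PowerSeries.X_ne_zero this)
  · have h1 : 2 * cst ((1 + g)⁻¹) = 1 := by
      have := congrArg cst (Matrix.mul_nonsing_inv _ hg1)
      rwa [map_mul, map_add, hcg, map_one, one_add_one_eq_two] at this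
    change cst M = _
    have h3 : cst g₁ = -((z + y) * 2) := by
      rw [map_add, hcX, map_sub, map_neg, map_mul cst 2 P, map_mul cst 2 Q, hP, hQ, map_ofNat,
        add_zero, ← one_add_one_eq_two]
      noncomm_ring
    rw [map_mul, map_neg, h3, neg_neg, mul_assoc, h1, mul_one]
  · have hw : cayley ((X : PowerSeries k) • M) = g := by rw [hM, cayley_cayley h2u hg1]
    have hcomm : cayley ((X : PowerSeries k) • ι y) * ι x =
        ι x * cayley ((X : PowerSeries k) • ι y) := by
      refine cayley_mul_comm (hunit _) ?_
      rw [Matrix.smul_mul, Matrix.mul_smul, ← map_mul, hyx, map_mul]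
    have hyo : cayley ((X : PowerSeries k) • ι y) *
        (cayley ((X : PowerSeries k) • ι y)).transpose = 1 :=
      mul_eq_one_comm.1 (cayley_transpose_mul_self (hunit (ι y)) (hskew y hy))
    have hgd : g = cayley ((X : PowerSeries k) • ι z) * cayley ((X : PowerSeries k) • ι y) := rfl
    rw [hw, hgd]
    change _ * ι x * _ = _
    rw [Matrix.transpose_mul, mul_assoc (cayley _), hcomm]
    calc _ = cayley ((X : PowerSeries k) • ι z) * ι x * (cayley ((X : PowerSeries k) • ι y) *
        (cayley ((X : PowerSeries k) • ι y)).transpose) *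
          (cayley ((X : PowerSeries k) • ι z)).transpose := by noncomm_ring
      _ = _ := by rw [hyo, mul_one]

theorem exists_eq_combMatrix (κ : Module.Basis τ k (signedCentralizer (-1 : k) (0 : Matrix n n k)))
    {M : Matrix n n (PowerSeries k)} (hM : M.transpose = -M) (v : τ → k)
    (hv : (PowerSeries.constantCoeff (R := k)).mapMatrix M = ∑ i, v i • (κ i : Matrix n n k)) :
    ∃ N : τ → PowerSeries k, (∀ i, PowerSeries.constantCoeff (N i) = v i) ∧
      M = combMatrix (fun i => (κ i : Matrix n n k)) N := by
  have hskew (j : ℕ) : M.map (PowerSeries.coeff j) ∈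
      signedCentralizer (-1 : k) (0 : Matrix n n k) := by
    refine ⟨?_, by simp⟩
    ext p q
    have := congrArg (PowerSeries.coeff j) (congrFun (congrFun hM p) q)
    simpa using this
  refine ⟨fun i => PowerSeries.mk fun j => κ.repr ⟨_, hskew j⟩ i, fun i => ?_, ?_⟩
  · rw [← PowerSeries.coeff_zero_eq_constantCoeff_apply, PowerSeries.coeff_mk]
    have : (⟨_, hskew 0⟩ : signedCentralizer (-1 : k) (0 : Matrix n n k)) = ∑ i, v i • κ i := by
      apply Subtype.ext
      rw [Submodule.coe_sum]
      simp only [Submodule.coe_smul]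
      rw [← hv]
      ext p q
      simp
    rw [this, κ.repr_sum_self]
  · ext p q j
    have h := congrArg Subtype.val (κ.sum_repr ⟨_, hskew j⟩)
    rw [Submodule.coe_sum] at h
    have h' := congrFun (congrFun h p) q
    simp only [Submodule.coe_smul, Matrix.sum_apply, Matrix.smul_apply, smul_eq_mul,
      Matrix.map_apply] at h'
    rw [← h', combMatrix, Matrix.sum_apply, map_sum]
    refine Finset.sum_congr rfl fun i _ => ?_
    simp [mul_comm]

/-- It suffices to let `u` vary in a complement of the centralizer of `x` in the skew-symmetric
matrices: a polynomial that vanishes at `D · cayley u` applied to `x` for all `u` in the complement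
vanishes there for all skew-symmetric `u`. Otherwise a skew-symmetric matrix `v` exists at which the
lowest homogeneous component of the numerator `r` of its pullback does not vanish, and an arc with
tangent direction `v` gives a contradiction. -/
theorem genericOrbitEval_eq_zero [Infinite k] (h2 : (2 : k) ≠ 0) (D x : Matrix n n k)
    (κ : Module.Basis τ k (signedCentralizer (-1 : k) (0 : Matrix n n k)))
    {τ' : Type*} [Fintype τ'] (κ' : τ' → Matrix n n k) (hκ' : ∀ i, (κ' i).transpose = -κ' i)
    (hspan : ∀ V : Matrix n n k, V.transpose = -V → ∃ c : τ' → k,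
      V - ∑ i, c i • κ' i ∈ signedCentralizer (-1 : k) x)
    (P : MvPolynomial (n × n) k) (hP : genericOrbitEval D x κ' P = 0) :
    genericOrbitEval D x (fun i => (κ i : Matrix n n k)) P = 0 := by
  set κ₀ : τ → Matrix n n k := fun i => (κ i : Matrix n n k) with hκ₀
  by_contra hne
  obtain ⟨m, r, hr⟩ := IsLocalization.Away.surj (genericDet κ₀) (genericOrbitEval D x κ₀ P)
  have hunitm : IsUnit (algebraMap (MvPolynomial τ k) (CayleyRing κ₀) (genericDet κ₀) ^ m) :=
    (IsLocalization.Away.algebraMap_isUnit _).pow m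
  have hr0 : r ≠ 0 := by
    rintro rfl
    rw [map_zero] at hr
    exact hne ((hunitm.mul_left_eq_zero).1 hr)
  obtain ⟨v, hv⟩ := exists_forall_aeval_X_mul_ne_zero hr0
  have hκs (i : τ) : (κ₀ i).transpose = -κ₀ i := by
    simpa using (κ i).2.1
  -- The component `z` of `v` in the complement; the remainder commutes with `x`.
  obtain ⟨c, hc⟩ := hspan (∑ i, v i • κ₀ i) (by
    rw [Matrix.transpose_sum, ← Finset.sum_neg_distrib]
    simp only [Matrix.transpose_smul, hκs, smul_neg])
  set z := ∑ i, c i • κ' i with hz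
  have hzs : z.transpose = -z := by
    rw [hz, Matrix.transpose_sum, ← Finset.sum_neg_distrib]
    simp only [Matrix.transpose_smul, hκ', smul_neg]
  obtain ⟨M, hMs, hMc, hMu, hzu, hMz⟩ := exists_arc h2 hzs
    (y := (∑ i, v i • κ₀ i) - z) (by simpa using hc.1) hc.2.symm
  obtain ⟨N, hN, hMN⟩ := exists_eq_combMatrix κ hMs v (by rw [hMc]; abel)
  have e1 : combMatrix κ₀ (fun i => PowerSeries.X * N i) = (PowerSeries.X : PowerSeries k) • M := by
    rw [hMN, combMatrix, combMatrix, Finset.smul_sum]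
    simp only [mul_smul]
    rfl
  have e2 : combMatrix κ' (fun i => PowerSeries.X * algebraMap k (PowerSeries k) (c i)) =
      (PowerSeries.X : PowerSeries k) • (algebraMap k (PowerSeries k)).mapMatrix z := by
    ext p q : 2
    simp [hz, combMatrix, Matrix.sum_apply, Finset.mul_sum, mul_assoc]
  obtain ⟨φ, hφ, hφ'⟩ := exists_specialization D x κ₀ (fun i => PowerSeries.X * N i)
    (by rw [e1]; exact hMu)
  obtain ⟨φ', -, hφ''⟩ := exists_specialization D x κ'
    (fun i => PowerSeries.X * algebraMap k (PowerSeries k) (c i)) (by rw [e2]; exact hzu)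
  have hzero : φ (genericOrbitEval D x κ₀ P) = 0 := by
    rw [← AlgHom.comp_apply, hφ', orbitEval, e1, hMz, ← e2, ← orbitEval, ← hφ'',
      AlgHom.comp_apply, hP, map_zero]
  refine hv N hN ?_
  rw [← hφ, ← hr, map_mul, hzero, zero_mul]

/-- The dimension of a set that is contained in the orbit of `x` under the orthogonal group. The
group is covered by finitely many translates of the image of the Cayley transform. -/
theorem zariskiDim_le_of_orbit [Infinite k] (h2 : (2 : k) ≠ 0) {E : Type*} [AddCommGroup E]
    [Module k E] (e : E ≃ₗ[k] Matrix n n k) (x : Matrix n n k) (S : Set E)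
    (hS : ∀ s ∈ S, ∃ g : Matrix n n k, g.transpose * g = 1 ∧ e s = g * x * g.transpose) (d : ℕ)
    (hd : Module.finrank k (signedCentralizer (-1 : k) (0 : Matrix n n k)) ≤
      d + Module.finrank k (signedCentralizer (-1 : k) x)) :
    zariskiDim (k := k) S ≤ d := by
  let K := signedCentralizer (-1 : k) (0 : Matrix n n k)
  have hle : signedCentralizer (-1 : k) x ≤ K := fun A hA => ⟨hA.1, by simp⟩
  obtain ⟨N₀, hN₀⟩ := Submodule.exists_isCompl ((signedCentralizer (-1 : k) x).submoduleOf K)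
  let N : Submodule k (Matrix n n k) := N₀.map K.subtype
  have hNK : N ≤ K := Submodule.map_subtype_le K N₀
  have hNd : Module.finrank k N ≤ d := by
    have h1 := Submodule.finrank_add_eq_of_isCompl hN₀
    have h3 : Module.finrank k ((signedCentralizer (-1 : k) x).submoduleOf K) =
        Module.finrank k (signedCentralizer (-1 : k) x) :=
      (Submodule.submoduleOfEquivOfLe hle).finrank_eq
    have h4 : Module.finrank k N = Module.finrank k N₀ := Submodule.finrank_map_subtype_eq K N₀
    change Module.finrank k K ≤ _ at hd
    omega
  let κ := Module.finBasis k K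
  let β := Module.finBasis k N
  let κ' : Fin (Module.finrank k N) → Matrix n n k := fun i => (β i : Matrix n n k)
  have hκ' (i) : (κ' i).transpose = -κ' i := by simpa using (hNK (β i).2).1
  have hspan (V : Matrix n n k) (hV : V.transpose = -V) : ∃ c : Fin (Module.finrank k N) → k,
      V - ∑ i, c i • κ' i ∈ signedCentralizer (-1 : k) x := by
    have hVK : V ∈ K := ⟨by simpa using hV, by simp⟩
    have : (⟨V, hVK⟩ : K) ∈ (signedCentralizer (-1 : k) x).submoduleOf K ⊔ N₀ := by
      rw [hN₀.sup_eq_top]; trivial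
    obtain ⟨y, hy, z, hz, hyz⟩ := Submodule.mem_sup.1 this
    have hzN : (z : Matrix n n k) ∈ N := ⟨z, hz, rfl⟩
    refine ⟨β.repr ⟨z, hzN⟩, ?_⟩
    have h1 := congrArg Subtype.val (β.sum_repr ⟨z, hzN⟩)
    rw [Submodule.coe_sum] at h1
    have h3 : V = (y : Matrix n n k) + z := (congrArg Subtype.val hyz).symm
    have h4 : ∑ i, β.repr ⟨z, hzN⟩ i • κ' i = z := h1
    rw [h4, h3, add_sub_cancel_right]
    exact hy
  let D : (n → Bool) → Matrix n n k := fun s => Matrix.diagonal fun i => boolSign k (s i)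
  refine zariskiDim_le_of_family ((Matrix.stdBasis k n n).map e.symm) S
    (fun s : n → Bool => genericOrbitEval (D s) x κ') ?_ d fun s => ?_
  · intro P hP s hs
    obtain ⟨g, hg, hgs⟩ := hS s hs
    obtain ⟨t, u, hu, hu1, rfl⟩ := exists_eq_sign_mul_cayley h2 hg
    have h0 := genericOrbitEval_eq_zero h2 (D t) x κ κ' hκ' hspan P (hP t)
    have huK : u ∈ K := ⟨by simpa using hu, by simp⟩
    have hcomb : combMatrix (fun i => (κ i : Matrix n n k)) (κ.repr ⟨u, huK⟩) = u := by
      have h1 := congrArg Subtype.val (κ.sum_repr ⟨u, huK⟩)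
      rw [Submodule.coe_sum] at h1
      exact h1
    obtain ⟨φ, -, hφ⟩ := exists_specialization (B := k) (D t) x (fun i => (κ i : Matrix n n k))
      (κ.repr ⟨u, huK⟩) (by rw [hcomb]; exact hu1)
    have h3 := DFunLike.congr_fun hφ P
    rw [AlgHom.comp_apply, h0, map_zero, orbitEval, hcomb] at h3
    rw [← MvPolynomial.aeval_eq_eval, h3]
    refine congrArg (fun f => MvPolynomial.aeval f P) (funext fun p => ?_)
    rw [Module.Basis.map_repr, LinearEquiv.symm_symm, LinearEquiv.trans_apply, hgs,
      Matrix.transpose_mul]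
    have hst (A : Matrix n n k) : (Matrix.stdBasis k n n).repr A p = A p.1 p.2 := by
      rcases p with ⟨i, j⟩
      simp [Matrix.stdBasis]
    rw [hst]
    have hid (A : Matrix n n k) : (algebraMap k k).mapMatrix A = A := rfl
    rw [hid, hid]
    simp only [mul_assoc]
    rfl
  · refine ringKrullDim_quotient_ker_le_trdeg _ d ?_
    refine (trdeg_localizationAway_mvPolynomial_le _ (genericDet_ne_zero κ')).trans ?_
    rw [Fintype.card_fin]
    exact_mod_cast hNd

end Orbit

/-! ### Submodules of symmetric matrices that are stable under rotations -/

section Rotation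

variable {k : Type*} [Field k] {n : Type*}

/-- The rotation in the coordinate plane of `a` and `b` with cosine `c` and sine `s`. -/
def rotation [DecidableEq n] (a b : n) (c s : k) : Matrix n n k :=
  1 + (c - 1) • (Matrix.single a a 1 + Matrix.single b b 1) +
    s • (Matrix.single b a 1 - Matrix.single a b 1)

theorem rotation_mul [Fintype n] [DecidableEq n] {a b : n} (hab : a ≠ b) (c s c' s' : k) :
    rotation a b c s * rotation a b c' s' = rotation a b (c * c' - s * s') (s * c' + c * s') := by
  have hba := hab.symm
  simp only [rotation, mul_add, add_mul, mul_sub, sub_mul, Matrix.smul_mul, Matrix.mul_smul,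
    mul_one, one_mul, Matrix.single_mul_single_same, ne_eq, hab, hba, not_false_eq_true,
    Matrix.single_mul_single_of_ne, smul_add, smul_sub, smul_zero, add_zero, zero_add, sub_zero,
    zero_sub]
  module

theorem rotation_transpose [DecidableEq n] (a b : n) (c s : k) :
    (rotation a b c s).transpose = rotation a b c (-s) := by
  simp only [rotation, Matrix.transpose_add, Matrix.transpose_one, Matrix.transpose_smul,
    Matrix.transpose_sub, Matrix.transpose_single]
  module

theorem rotation_one_zero [DecidableEq n] (a b : n) : rotation a b (1 : k) 0 = 1 := by
  simp [rotation]

theorem rotation_transpose_mul_self [Fintype n] [DecidableEq n] {a b : n} (hab : a ≠ b) {c s : k}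
    (h : c ^ 2 + s ^ 2 = 1) :
    (rotation a b c s).transpose * rotation a b c s = 1 := by
  rw [rotation_transpose, rotation_mul hab, ← rotation_one_zero a b]
  congr 1
  · linear_combination h
  · ring

/-- Every rotation which is the square of a rotation has determinant `1`. -/
theorem det_rotation_sq [Fintype n] [DecidableEq n] {a b : n} (hab : a ≠ b) {c s : k}
    (h : c ^ 2 + s ^ 2 = 1) :
    (rotation a b (c * c - s * s) (s * c + c * s)).det = 1 := by
  rw [← rotation_mul hab, Matrix.det_mul]
  have := congrArg Matrix.det (rotation_transpose_mul_self hab h)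
  rwa [Matrix.det_mul, Matrix.det_transpose, Matrix.det_one] at this

theorem rotation_mulVec [Fintype n] [DecidableEq n] (a b : n) (c s : k) (v : n → k) :
    (rotation a b c s).mulVec v = v + ((c - 1) * v a - s * v b) • Pi.single a 1 +
      (s * v a + (c - 1) * v b) • Pi.single b 1 := by
  ext i
  simp [rotation, Matrix.add_mulVec, Matrix.sub_mulVec, Matrix.smul_mulVec, Matrix.single_mulVec,
    Pi.single_apply, Function.update_apply]
  split_ifs <;> ring

/-- The matrix `v wᵀ + w vᵀ`. -/
def symProd (v w : n → k) : Matrix n n k := Matrix.vecMulVec v w + Matrix.vecMulVec w v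

theorem mul_symProd_mul [Fintype n] (G : Matrix n n k) (v w : n → k) :
    G * symProd v w * G.transpose = symProd (G.mulVec v) (G.mulVec w) := by
  simp only [symProd, mul_add, add_mul, Matrix.mul_vecMulVec, Matrix.vecMulVec_mul,
    Matrix.vecMul_transpose]

/-- The diagonal matrix with entries `-1` at `a` and `b` and `1` elsewhere. -/
def signFlip [DecidableEq n] (a b : n) : Matrix n n k :=
  Matrix.diagonal fun i => if i = a ∨ i = b then -1 else 1

theorem signFlip_transpose [DecidableEq n] (a b : n) :
    (signFlip a b : Matrix n n k).transpose = signFlip a b :=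
  Matrix.diagonal_transpose _

theorem signFlip_mul_self [Fintype n] [DecidableEq n] (a b : n) :
    (signFlip a b : Matrix n n k).transpose * signFlip a b = 1 := by
  rw [signFlip_transpose, signFlip, Matrix.diagonal_mul_diagonal, ← Matrix.diagonal_one]
  congr 1
  ext i
  split_ifs <;> simp

theorem det_signFlip [Fintype n] [DecidableEq n] {a b : n} (hab : a ≠ b) :
    (signFlip a b : Matrix n n k).det = 1 := by
  rw [signFlip, Matrix.det_diagonal, Finset.prod_ite, Finset.prod_const, Finset.prod_const_one,
    mul_one, show (Finset.univ.filter fun i => i = a ∨ i = b) = {a, b} by ext; simp,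
    Finset.card_pair hab]
  norm_num

theorem signFlip_conj_apply [Fintype n] [DecidableEq n] (a b : n) (A : Matrix n n k) (i j : n) :
    ((signFlip a b : Matrix n n k) * A * (signFlip a b : Matrix n n k).transpose) i j =
      (if i = a ∨ i = b then -1 else 1) * A i j * (if j = a ∨ j = b then -1 else 1) := by
  rw [signFlip_transpose, signFlip, Matrix.mul_diagonal, Matrix.diagonal_mul]

/-- A submodule of matrices is rotation-stable if it is stable under congruence, equivalently
conjugation, by all orthogonal matrices of determinant `1`. -/
def IsRotationStable [Fintype n] [DecidableEq n] (U : Submodule k (Matrix n n k)) : Prop :=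
  ∀ G : Matrix n n k, G.transpose * G = 1 → G.det = 1 → ∀ A ∈ U, G * A * G.transpose ∈ U

/-- Half the difference of `A` and its conjugate by a sign change retains the entries for which one
of the two indices is in `{a, b}` and the other one is not. -/
theorem IsRotationStable.mask [Fintype n] [DecidableEq n] (h2 : (2 : k) ≠ 0)
    {U : Submodule k (Matrix n n k)} (hU : IsRotationStable U) {a b : n} (hab : a ≠ b)
    {A : Matrix n n k} (hA : A ∈ U) :
    (Matrix.of fun i j => if (i = a ∨ i = b) ↔ (j = a ∨ j = b) then 0 else A i j) ∈ U := by
  have h := hU _ (signFlip_mul_self a b) (det_signFlip hab) A hA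
  have : (Matrix.of fun i j => if (i = a ∨ i = b) ↔ (j = a ∨ j = b) then 0 else A i j) =
      (2⁻¹ : k) • (A - (signFlip a b : Matrix n n k) * A *
        (signFlip a b : Matrix n n k).transpose) := by
    ext i j
    rw [Matrix.smul_apply, Matrix.sub_apply, signFlip_conj_apply, Matrix.of_apply, smul_eq_mul]
    by_cases hi : i = a ∨ i = b <;> by_cases hj : j = a ∨ j = b <;> simp only [hi, hj, if_true,
      if_false, iff_self, iff_true, iff_false, not_true_eq_false] <;> field_simp <;> ring
  rw [this]
  exact U.smul_mem _ (U.sub_mem hA h)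

/-- Sign changes isolate a nonzero off-diagonal entry, as there are at least five coordinates. -/
theorem IsRotationStable.symProd_mem_of_offDiag [Fintype n] [DecidableEq n] (h2 : (2 : k) ≠ 0)
    (hn : 5 ≤ Fintype.card n) {U : Submodule k (Matrix n n k)} (hU : IsRotationStable U)
    {A : Matrix n n k} (hA : A ∈ U) (hAs : A.transpose = A) {a b : n} (hab : a ≠ b)
    (hne : A a b ≠ 0) : symProd (Pi.single a 1) (Pi.single b 1) ∈ U := by
  have hex (T : Finset n) (hT : T.card < 5) : ∃ c, c ∉ T := by
    by_contra! h
    have : Finset.univ ⊆ T := fun x _ => h x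
    have := Finset.card_le_card this
    rw [Finset.card_univ] at this
    omega
  obtain ⟨c, hc⟩ := hex {a, b} (lt_of_le_of_lt Finset.card_le_two (by norm_num))
  obtain ⟨d, hd⟩ := hex {a, b, c} (lt_of_le_of_lt Finset.card_le_three (by norm_num))
  obtain ⟨e, he⟩ := hex {a, b, c, d} (lt_of_le_of_lt Finset.card_le_four (by norm_num))
  simp only [Finset.mem_insert, Finset.mem_singleton, not_or] at hc hd he
  -- Only `{a, b}` is separated by all of `{a, c}`, `{a, d}`, `{a, e}` and `{b, c}`.
  have h1 := hU.mask h2 (Ne.symm hc.1) hA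
  have h3 := hU.mask h2 (Ne.symm hd.1) h1
  have h4 := hU.mask h2 (Ne.symm he.2.1) h3
  have h5 := hU.mask h2 (Ne.symm hc.2) h4
  refine (U.smul_mem_iff hne).1 ?_
  convert h5 using 1
  have hba : A b a = A a b := congrFun (congrFun hAs a) b
  ext i j
  simp only [symProd, Matrix.smul_apply, Matrix.add_apply, Matrix.vecMulVec_apply, Matrix.of_apply,
    Pi.single_apply, smul_eq_mul]
  grind

theorem symProd_comm (v w : n → k) : symProd v w = symProd w v := add_comm _ _

theorem symProd_add (v w w' : n → k) : symProd v (w + w') = symProd v w + symProd v w' := by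
  simp only [symProd, Matrix.vecMulVec_add, Matrix.add_vecMulVec]; abel

theorem symProd_smul (v w : n → k) (c : k) : symProd v (c • w) = c • symProd v w := by
  simp only [symProd, Matrix.vecMulVec_smul, Matrix.smul_vecMulVec, smul_add]

theorem sum_smul_symProd [Fintype n] [DecidableEq n] (C : Matrix n n k) :
    ∑ i, ∑ j, C i j • symProd (Pi.single i 1) (Pi.single j (1 : k)) = C + C.transpose := by
  ext p q
  simp [Matrix.sum_apply, symProd, Matrix.vecMulVec_apply, Pi.single_apply,
    Finset.sum_add_distrib]

/-- There is a rotation of determinant `1` whose angle is not a multiple of a quarter turn. -/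
theorem exists_generic_rotation [Fintype n] [DecidableEq n] [IsAlgClosed k] (h2 : (2 : k) ≠ 0) :
    ∃ c s : k, c * s ≠ 0 ∧ ∀ a b : n, a ≠ b → (rotation a b c s).det = 1 ∧
      (rotation a b c s).transpose * rotation a b c s = 1 := by
  classical
  obtain ⟨t, ht⟩ := Infinite.exists_notMem_finset ({0, 1, 2⁻¹} : Finset k)
  simp only [Finset.mem_insert, Finset.mem_singleton, not_or] at ht
  obtain ⟨c, hc⟩ := IsAlgClosed.exists_eq_mul_self t
  obtain ⟨s, hs⟩ := IsAlgClosed.exists_eq_mul_self (1 - t)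
  have h : c ^ 2 + s ^ 2 = 1 := by linear_combination -hc - hs
  have hc0 : c ≠ 0 := by rintro rfl; exact ht.1 (by simpa using hc)
  have hs0 : s ≠ 0 := by
    rintro rfl
    exact ht.2.1 (by linear_combination -hs)
  refine ⟨c * c - s * s, s * c + c * s, mul_ne_zero ?_ ?_, fun a b hab =>
    ⟨det_rotation_sq hab h, ?_⟩⟩
  · rw [← hc, ← hs]
    intro h0
    apply ht.2.2
    refine eq_inv_of_mul_eq_one_left ?_
    linear_combination h0
  · rw [show s * c + c * s = 2 * (c * s) by ring]
    exact mul_ne_zero h2 (mul_ne_zero hc0 hs0)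
  · refine rotation_transpose_mul_self hab ?_
    linear_combination (c ^ 2 + s ^ 2 + 1) * h

/-- A rotation-stable submodule of symmetric matrices that contains a non-scalar matrix contains
all symmetric matrices of trace zero. -/
theorem IsRotationStable.mem_of_trace_eq_zero [Fintype n] [DecidableEq n] [IsAlgClosed k]
    (h2 : (2 : k) ≠ 0) (hn : 5 ≤ Fintype.card n) {U : Submodule k (Matrix n n k)}
    (hU : IsRotationStable U) (hsymm : ∀ A ∈ U, A.transpose = A) {A : Matrix n n k} (hA : A ∈ U)
    (hns : ∀ c : k, A ≠ c • (1 : Matrix n n k)) {C : Matrix n n k} (hC : C.transpose = C)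
    (htr : C.trace = 0) : C ∈ U := by
  obtain ⟨c, s, hcs, hrot⟩ := exists_generic_rotation (n := n) h2
  have hs0 : s ≠ 0 := right_ne_zero_of_mul hcs
  -- A matrix in `U` with a nonzero off-diagonal entry: rotate if `A` is diagonal.
  obtain ⟨A', hA', a, b, hab, hne⟩ : ∃ A' ∈ U, ∃ a b, a ≠ b ∧ A' a b ≠ 0 := by
    by_contra! hdiag
    have hoff := hdiag A hA
    have : ∃ a b, A a a ≠ A b b := by
      by_contra! heq
      have : Nonempty n := Fintype.card_pos_iff.1 (by omega)
      let i₀ := this.some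
      refine hns (A i₀ i₀) ?_
      ext i j
      by_cases hij : i = j
      · subst hij; simp [heq i i₀]
      · simp [hij, hoff i j hij]
    obtain ⟨a, b, hne⟩ := this
    have hab : a ≠ b := by rintro rfl; exact hne rfl
    have hba := hab.symm
    have hAd : A = Matrix.diagonal fun i => A i i := by
      ext i j
      by_cases hij : i = j
      · subst hij; simp
      · simp [hij, hoff i j hij]
    have hmem := hU _ (hrot a b hab).2 (hrot a b hab).1 A hA
    have h0 := hdiag _ hmem a b hab
    have hra (i : n) : rotation a b c s a i = if i = a then c else if i = b then -s else 0 := by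
      simp only [rotation, Matrix.add_apply, Matrix.smul_apply, Matrix.sub_apply,
        Matrix.single_apply, Matrix.one_apply, smul_eq_mul]
      grind
    have hrb (i : n) : rotation a b c s b i = if i = a then s else if i = b then c else 0 := by
      simp only [rotation, Matrix.add_apply, Matrix.smul_apply, Matrix.sub_apply,
        Matrix.single_apply, Matrix.one_apply, smul_eq_mul]
      grind
    rw [Matrix.mul_apply] at h0
    have hsum : ∑ i, (rotation a b c s * A) a i * (rotation a b c s).transpose i b =
        c * s * (A a a - A b b) := by
      rw [hAd]
      simp only [Matrix.mul_diagonal, Matrix.transpose_apply, hra, hrb, Matrix.diagonal_apply_eq]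
      rw [Finset.sum_eq_add a b hab (fun i _ hi => by simp [hi.1, hi.2]) (by simp) (by simp)]
      simp only [if_true, hba, if_false]
      ring
    rw [hsum] at h0
    exact mul_ne_zero hcs (sub_ne_zero.2 hne) h0
  have hab' := hU.symProd_mem_of_offDiag h2 hn hA' (hsymm A' hA') hab hne
  -- A rotation in the plane of `i` and `l` takes the product of `i` and `j` to that of `l` and `j`.
  have hstep (i j l : n) (hij : i ≠ j) (hlj : l ≠ j)
      (h : symProd (Pi.single i 1) (Pi.single j 1) ∈ U) :
      symProd (Pi.single l 1) (Pi.single j (1 : k)) ∈ U := by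
    by_cases hil : i = l
    · rwa [← hil]
    have hmem := hU _ (hrot i l hil).2 (hrot i l hil).1 _ h
    rw [mul_symProd_mul, rotation_mulVec, rotation_mulVec] at hmem
    simp only [Pi.single_eq_same, Pi.single_eq_of_ne hij, Pi.single_eq_of_ne hlj, mul_zero,
      sub_zero, add_zero, zero_smul, mul_one, Pi.single_eq_of_ne (Ne.symm hil)] at hmem
    rw [symProd_comm, symProd_add, symProd_add, symProd_smul, symProd_smul,
      symProd_comm, symProd_comm _ (Pi.single l 1)] at hmem
    have h' := U.sub_mem hmem (U.add_mem h (U.smul_mem (c - 1) h))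
    rw [add_sub_cancel_left] at h'
    exact (U.smul_mem_iff hs0).1 h'
  have hoff (i j : n) (hij : i ≠ j) : symProd (Pi.single i 1) (Pi.single j (1 : k)) ∈ U := by
    by_cases hib : i = b
    · subst hib
      have h1 : symProd (Pi.single i 1) (Pi.single a (1 : k)) ∈ U := by rwa [symProd_comm]
      rw [symProd_comm]
      exact hstep a i j hab hij.symm hab'
    · have h1 := hstep a b i hab hib hab'
      rw [symProd_comm] at h1 ⊢
      exact hstep b i j (Ne.symm hib) hij.symm h1
  have hdiag (i j : n) : Matrix.single i i 1 - Matrix.single j j (1 : k) ∈ U := by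
    by_cases hij : i = j
    · rw [hij, sub_self]; exact U.zero_mem
    have h := hoff i j hij
    have hmem := hU _ (hrot i j hij).2 (hrot i j hij).1 _ h
    rw [mul_symProd_mul, rotation_mulVec, rotation_mulVec] at hmem
    simp only [Pi.single_eq_same, Pi.single_eq_of_ne hij, mul_zero,
      sub_zero, add_zero, zero_add, zero_sub, mul_one, Pi.single_eq_of_ne (Ne.symm hij)] at hmem
    have hcs2 : (-(2 * (c * s))) ≠ 0 := neg_ne_zero.2 (mul_ne_zero h2 hcs)
    have h' := U.sub_mem hmem (U.smul_mem (c * c - s * s) h)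
    refine (U.smul_mem_iff hcs2).1 ?_
    convert h' using 1
    have hs1 (p q : n) : Matrix.single p q (1 : k) =
        Matrix.vecMulVec (Pi.single p 1) (Pi.single q 1) := by
      rw [Matrix.single_eq_single_vecMulVec_single]
    simp only [symProd, Matrix.vecMulVec_add, Matrix.add_vecMulVec, Matrix.vecMulVec_smul,
      Matrix.smul_vecMulVec, hs1]
    module
  -- Write `C` through off-diagonal products and differences of diagonal matrix units.
  have : Nonempty n := Fintype.card_pos_iff.1 (by omega)
  let o := this.some
  have hCeq : C = ∑ i, ∑ j, (if i = j then C i i • (Matrix.single i i 1 - Matrix.single o o (1 : k))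
      else (2⁻¹ * C i j) • symProd (Pi.single i 1) (Pi.single j 1)) := by
    have hsum := sum_smul_symProd C
    rw [hC, ← two_smul k] at hsum
    have hterm (i j : n) : (if i = j then
        C i i • (Matrix.single i i 1 - Matrix.single o o (1 : k))
        else (2⁻¹ * C i j) • symProd (Pi.single i 1) (Pi.single j 1)) =
        (2⁻¹ : k) • C i j • symProd (Pi.single i 1) (Pi.single j (1 : k)) -
          if i = j then C i i • Matrix.single o o (1 : k) else 0 := by
      split_ifs with hij
      · subst hij
        rw [symProd, ← two_smul k, smul_sub, Matrix.single_eq_single_vecMulVec_single,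
          smul_comm _ (2 : k), smul_smul (2⁻¹ : k) 2, inv_mul_cancel₀ h2, one_smul]
      · rw [sub_zero, smul_smul]
    simp only [hterm, Finset.sum_sub_distrib, ← Finset.smul_sum, hsum, Finset.sum_ite_eq,
      Finset.mem_univ, if_true, ← Finset.sum_smul]
    have htr' : ∑ i, C i i = 0 := htr
    rw [htr', zero_smul, sub_zero, smul_smul, inv_mul_cancel₀ h2, one_smul]
  rw [hCeq]
  refine U.sum_mem fun i _ => U.sum_mem fun j _ => ?_
  split_ifs with hij
  · exact U.smul_mem _ (hdiag i o)
  · exact U.smul_mem _ (hoff i j hij)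

end Rotation

/-! ### Ranks of skew-symmetric matrices -/

section Rank

variable {k : Type*} [Field k] {n : Type*} [Fintype n]

/-- A nonzero skew-symmetric matrix has two independent columns. -/
theorem two_le_rank_of_skew (h2 : (2 : k) ≠ 0) {X : Matrix n n k} (hX : X.transpose = -X)
    (h0 : X ≠ 0) : 2 ≤ X.rank := by
  have hdiag (i : n) : X i i = 0 := by
    have h : X i i = -X i i := congrFun (congrFun hX i) i
    exact (mul_eq_zero.1 (by linear_combination h : 2 * X i i = 0)).resolve_left h2
  obtain ⟨a, b, hab⟩ : ∃ a b, X a b ≠ 0 := by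
    by_contra! h
    exact h0 (Matrix.ext h)
  have hba : X b a = -X a b := congrFun (congrFun hX a) b
  rw [Matrix.rank_eq_finrank_span_cols]
  have hli : LinearIndependent k ![X.col a, X.col b] := by
    rw [LinearIndependent.pair_iff]
    intro s t hst
    have ha := congrFun hst a
    have hb := congrFun hst b
    simp [Matrix.col_apply, hdiag, hba, hab] at ha hb
    exact ⟨hb, ha⟩
  have h1 : Module.finrank k (Submodule.span k (Set.range ![X.col a, X.col b])) = 2 :=
    finrank_span_eq_card hli
  rw [← h1]
  refine Submodule.finrank_mono (Submodule.span_mono ?_)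
  rintro _ ⟨i, rfl⟩
  fin_cases i
  · exact ⟨a, rfl⟩
  · exact ⟨b, rfl⟩

theorem rank_sub_le (X Y : Matrix n n k) : (X - Y).rank ≤ X.rank + Y.rank := by
  have h : LinearMap.range (X - Y).mulVecLin ≤
      LinearMap.range X.mulVecLin ⊔ LinearMap.range Y.mulVecLin := by
    rintro _ ⟨v, rfl⟩
    rw [Matrix.mulVecLin_apply, Matrix.sub_mulVec]
    exact sub_mem (Submodule.mem_sup_left ⟨v, rfl⟩) (Submodule.mem_sup_right ⟨v, rfl⟩)
  exact (Submodule.finrank_mono h).trans (Submodule.finrank_add_le_finrank_add_finrank _ _)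

variable [DecidableEq n]

theorem card_le_two_mul_rank {X s : Matrix n n k} {c : k} (hc : c ≠ 0)
    (h : X * s - s * X = c • (1 : Matrix n n k)) : Fintype.card n ≤ 2 * X.rank := by
  have h1 : (c • (1 : Matrix n n k)).rank = Fintype.card n := by
    refine Matrix.rank_of_isUnit _ ?_
    rw [Matrix.isUnit_iff_isUnit_det, Matrix.det_smul, Matrix.det_one, mul_one]
    exact hc.isUnit.pow _
  rw [← h1, ← h, two_mul]
  exact (rank_sub_le _ _).trans
    (add_le_add (Matrix.rank_mul_le_left _ _) (Matrix.rank_mul_le_right _ _))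

/-- The symmetric matrices whose commutator with `X` is a scalar matrix. -/
def scalarCommutator (X : Matrix n n k) : Submodule k (Matrix n n k) :=
  signedCentralizer 1 0 ⊓ (Submodule.span k {(1 : Matrix n n k)}).comap
    (LinearMap.mulLeft k X - LinearMap.mulRight k X)

theorem mem_scalarCommutator {X A : Matrix n n k} :
    A ∈ scalarCommutator X ↔ A.transpose = A ∧ ∃ c : k, c • (1 : Matrix n n k) = X * A - A * X := by
  rw [scalarCommutator, Submodule.mem_inf, mem_signedCentralizer, Submodule.mem_comap,
    Submodule.mem_span_singleton]
  simp

/-- The space of `A` with scalar commutator exceeds the symmetric centralizer by at most one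
dimension, and only if some nonzero scalar matrix is a commutator with `X`, which forces `X`
to have rank at least `3`. -/
theorem finrank_scalarCommutator_add_le (h2 : (2 : k) ≠ 0) (hn : 5 ≤ Fintype.card n)
    {X : Matrix n n k} (hX : X.transpose = -X) (h0 : X ≠ 0) :
    Module.finrank k (signedCentralizer (-1 : k) (0 : Matrix n n k)) +
      Module.finrank k (scalarCommutator X) + 2 ≤
    Module.finrank k (signedCentralizer (-1 : k) X) +
      Module.finrank k (signedCentralizer (1 : k) (0 : Matrix n n k)) := by
  have e1 := finrank_signedCentralizer_zero (n := n) h2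
  have e2 := finrank_signedCentralizer_le X hX
  have hr := two_le_rank_of_skew h2 hX h0
  by_cases hall : ∀ A ∈ scalarCommutator X, X * A - A * X = 0
  · have : scalarCommutator X ≤ signedCentralizer (1 : k) X := fun A hA =>
      ⟨by rw [(mem_scalarCommutator.1 hA).1, one_smul], sub_eq_zero.1 (hall A hA)⟩
    have := Submodule.finrank_mono this
    omega
  · push Not at hall
    obtain ⟨A, hA, hne⟩ := hall
    obtain ⟨-, c, hc⟩ := mem_scalarCommutator.1 hA
    have hc0 : c ≠ 0 := by rintro rfl; rw [zero_smul] at hc; exact hne hc.symm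
    have hr' := card_le_two_mul_rank hc0 hc.symm
    let T : scalarCommutator X →ₗ[k] Submodule.span k {(1 : Matrix n n k)} :=
      (LinearMap.mulLeft k X - LinearMap.mulRight k X).restrict fun A hA => hA.2
    have hT1 := LinearMap.finrank_range_add_finrank_ker T
    have hT2 : Module.finrank k (LinearMap.range T) ≤ 1 :=
      (Submodule.finrank_le _).trans ((finrank_span_le_card _).trans (by simp))
    have hT3 : Module.finrank k (LinearMap.ker T) ≤
        Module.finrank k (signedCentralizer (1 : k) X) := by
      rw [← Submodule.finrank_map_subtype_eq]
      refine Submodule.finrank_mono ?_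
      rintro _ ⟨B, hB, rfl⟩
      refine ⟨by rw [Submodule.subtype_apply, (mem_scalarCommutator.1 B.2).1, one_smul], ?_⟩
      exact sub_eq_zero.1 (congrArg Subtype.val hB)
    omega

end Rank

/-! ### The symmetric square as a space of symmetric matrices -/

section Model

variable {k : Type*} [Field k] {V : Type*} [AddCommGroup V] [Module k V]
  {n : Type*} [Fintype n] (f : Module.Basis n k V)

/-- The map from `Sym² V` to symmetric matrices that takes `v w` to `v wᵀ + w vᵀ`, for the
coordinate vectors with respect to the basis `f`. -/
def symSqToMatrix : SymSq k V →ₗ[k] Matrix n n k :=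
  (symSqRel k V).liftQ
    (TensorProduct.lift (LinearMap.mk₂ k (fun v w => symProd (f.equivFun v) (f.equivFun w))
      (fun v v' w => by rw [map_add, symProd_comm, symProd_add, symProd_comm _ (f.equivFun v),
        symProd_comm _ (f.equivFun v')])
      (fun c v w => by rw [map_smul, symProd_comm, symProd_smul, symProd_comm])
      (fun v w w' => by rw [map_add, symProd_add])
      (fun c v w => by rw [map_smul, symProd_smul]))) (by
    refine Submodule.span_le.2 ?_
    rintro _ ⟨⟨v, w⟩, rfl⟩
    simp [symProd_comm (f.repr w)])

/-- The product of two vectors in the symmetric square. -/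
def symMk (v w : V) : SymSq k V := (symSqRel k V).mkQ (v ⊗ₜ w)

@[simp] theorem symSqToMatrix_symMk (v w : V) :
    symSqToMatrix f (symMk v w) = symProd (f.equivFun v) (f.equivFun w) := by
  simp [symSqToMatrix, symMk]

theorem symMk_comm (v w : V) : symMk (k := k) v w = symMk (k := k) w v := by
  rw [symMk, symMk, ← sub_eq_zero, ← map_sub, Submodule.mkQ_apply, Submodule.Quotient.mk_eq_zero]
  exact Submodule.subset_span ⟨(v, w), rfl⟩

theorem symSq_hom_ext {M : Type*} [AddCommGroup M] [Module k M] {φ ψ : SymSq k V →ₗ[k] M}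
    (h : ∀ v w, φ (symMk v w) = ψ (symMk v w)) : φ = ψ :=
  Submodule.linearMap_qext _ (TensorProduct.ext' h)

theorem symMk_sum_smul (c d : n → k) : symMk (k := k) (∑ i, c i • f i) (∑ j, d j • f j) =
    ∑ i, ∑ j, (c i * d j) • symMk (k := k) (f i) (f j) := by
  simp only [symMk, TensorProduct.sum_tmul, TensorProduct.tmul_sum, TensorProduct.smul_tmul_smul,
    map_sum, map_smul]
  exact Finset.sum_comm

/-- The map from matrices to `Sym² V` which takes the matrix with entries `A i j` to half the sum
of all `A i j • (f i) (f j)`. -/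
def matrixToSymSq : Matrix n n k →ₗ[k] SymSq k V where
  toFun A := (2⁻¹ : k) • ∑ i, ∑ j, A i j • symMk (f i) (f j)
  map_add' A B := by
    simp only [Matrix.add_apply, add_smul, Finset.sum_add_distrib, smul_add]
  map_smul' c A := by
    simp only [Matrix.smul_apply, smul_eq_mul, mul_smul, ← Finset.smul_sum, RingHom.id_apply]
    rw [smul_comm]

theorem matrixToSymSq_symSqToMatrix (h2 : (2 : k) ≠ 0) (w : SymSq k V) :
    matrixToSymSq f (symSqToMatrix f w) = w := by
  suffices h : matrixToSymSq f ∘ₗ symSqToMatrix f = LinearMap.id from LinearMap.congr_fun h w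
  refine symSq_hom_ext fun v w => ?_
  rw [LinearMap.comp_apply, symSqToMatrix_symMk, LinearMap.id_apply]
  have h1 : symMk (k := k) v w =
      ∑ i, ∑ j, (f.equivFun v i * f.equivFun w j) • symMk (f i) (f j) := by
    rw [← symMk_sum_smul, f.sum_equivFun, f.sum_equivFun]
  have h3 : symMk (k := k) v w =
      ∑ i, ∑ j, (f.equivFun w i * f.equivFun v j) • symMk (f i) (f j) := by
    rw [symMk_comm, ← symMk_sum_smul, f.sum_equivFun, f.sum_equivFun]
  change (2⁻¹ : k) • ∑ i, ∑ j, (symProd (f.equivFun v) (f.equivFun w)) i j •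
    symMk (k := k) (f i) (f j) = _
  simp only [symProd, Matrix.add_apply, Matrix.vecMulVec_apply, add_smul, Finset.sum_add_distrib,
    ← h1, ← h3]
  rw [← two_smul k, smul_smul, inv_mul_cancel₀ h2, one_smul]

theorem symSqToMatrix_injective (h2 : (2 : k) ≠ 0) : Function.Injective (symSqToMatrix f) :=
  Function.LeftInverse.injective (matrixToSymSq_symSqToMatrix f h2)

theorem symSqToMatrix_transpose (w : SymSq k V) :
    (symSqToMatrix f w).transpose = symSqToMatrix f w := by
  suffices h : (Matrix.transposeLinearEquiv n n k k).toLinearMap ∘ₗ symSqToMatrix f =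
    symSqToMatrix f from LinearMap.congr_fun h w
  refine symSq_hom_ext fun v w => ?_
  simp [symProd, Matrix.transpose_vecMulVec, add_comm]

variable [DecidableEq n]

theorem symSqToMatrix_matrixToSymSq (h2 : (2 : k) ≠ 0) {A : Matrix n n k} (hA : A.transpose = A) :
    symSqToMatrix f (matrixToSymSq f A) = A := by
  have hf (i : n) : f.equivFun (f i) = Pi.single i (1 : k) := by
    rw [f.equivFun_apply, f.repr_self, Finsupp.single_eq_pi_single]
  have h1 : symSqToMatrix f (matrixToSymSq f A) =
      (2⁻¹ : k) • ∑ i, ∑ j, A i j • symProd (Pi.single i 1) (Pi.single j (1 : k)) := by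
    change symSqToMatrix f ((2⁻¹ : k) • ∑ i, ∑ j, A i j • symMk (f i) (f j)) = _
    simp only [map_smul, map_sum, symSqToMatrix_symMk]
    simp only [hf]
  rw [h1, sum_smul_symProd, hA, ← two_smul k, smul_smul, inv_mul_cancel₀ h2, one_smul]

theorem finrank_symSq (f : Module.Basis n k V) (h2 : (2 : k) ≠ 0) : Module.finrank k (SymSq k V) =
    Module.finrank k (signedCentralizer (1 : k) (0 : Matrix n n k)) := by
  have : LinearMap.range (symSqToMatrix f) = signedCentralizer (1 : k) (0 : Matrix n n k) := by
    ext A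
    rw [mem_signedCentralizer, one_smul]
    constructor
    · rintro ⟨w, rfl⟩
      exact ⟨symSqToMatrix_transpose f w, by simp⟩
    · rintro ⟨hA, -⟩
      exact ⟨_, symSqToMatrix_matrixToSymSq f h2 hA⟩
  rw [← this, LinearMap.finrank_range_of_inj (symSqToMatrix_injective f h2)]

theorem symSqToMatrix_symSqMap (g : V →ₗ[k] V) (w : SymSq k V) :
    symSqToMatrix f (symSqMap g w) =
      LinearMap.toMatrix f f g * symSqToMatrix f w * (LinearMap.toMatrix f f g).transpose := by
  suffices h : symSqToMatrix f ∘ₗ symSqMap g =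
      LinearMap.mulRight k (LinearMap.toMatrix f f g).transpose ∘ₗ
        LinearMap.mulLeft k (LinearMap.toMatrix f f g) ∘ₗ symSqToMatrix f from
    LinearMap.congr_fun h w
  refine symSq_hom_ext fun v w => ?_
  have h1 : symSqMap g (symMk v w) = symMk (g v) (g w) := rfl
  have h3 (v : V) : f.equivFun (g v) = (LinearMap.toMatrix f f g).mulVec (f.equivFun v) :=
    (LinearMap.toMatrix_mulVec_repr f f g v).symm
  simp only [LinearMap.comp_apply, LinearMap.mulRight_apply, LinearMap.mulLeft_apply, h1,
    symSqToMatrix_symMk, mul_symProd_mul, h3]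

theorem symSqToMatrix_symSqDer (x : Module.End k V) (w : SymSq k V) :
    symSqToMatrix f (symSqDer x w) = LinearMap.toMatrix f f x * symSqToMatrix f w +
      symSqToMatrix f w * (LinearMap.toMatrix f f x).transpose := by
  suffices h : symSqToMatrix f ∘ₗ symSqDer x =
      LinearMap.mulLeft k (LinearMap.toMatrix f f x) ∘ₗ symSqToMatrix f +
        LinearMap.mulRight k (LinearMap.toMatrix f f x).transpose ∘ₗ symSqToMatrix f from
    LinearMap.congr_fun h w
  refine symSq_hom_ext fun v w => ?_
  have h1 : symSqDer x (symMk v w) = symMk (x v) w + symMk v (x w) := by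
    simp [symSqDer, symMk]
  have h3 (v : V) : f.equivFun (x v) = (LinearMap.toMatrix f f x).mulVec (f.equivFun v) :=
    (LinearMap.toMatrix_mulVec_repr f f x v).symm
  simp only [LinearMap.add_apply, LinearMap.comp_apply, LinearMap.mulRight_apply,
    LinearMap.mulLeft_apply, h1, map_add, symSqToMatrix_symMk, h3, symProd,
    Matrix.mul_vecMulVec, Matrix.vecMulVec_mul, Matrix.vecMul_transpose]
  abel

end Model

/-! ### Orthonormal bases and orthogonal matrices -/

section Orthonormal

variable {k : Type*} [Field k] {V : Type*} [AddCommGroup V] [Module k V]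
  {b : LinearMap.BilinForm k V} {n : Type*} [Fintype n] [DecidableEq n]
  {f : Module.Basis n k V}

/-- A basis that is orthonormal for the bilinear form `b`. -/
def IsOrthonormalBasis (b : LinearMap.BilinForm k V) (f : Module.Basis n k V) : Prop :=
  ∀ i j, b (f i) (f j) = if i = j then 1 else 0

theorem exists_isOrthonormalBasis [IsAlgClosed k] [FiniteDimensional k V] (h2 : (2 : k) ≠ 0)
    (hsymm : b.IsSymm) (hb : b.Nondegenerate) :
    ∃ f : Module.Basis (Fin (Module.finrank k V)) k V, IsOrthonormalBasis b f := by
  have : Invertible (2 : k) := invertibleOfNonzero h2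
  obtain ⟨v, hv⟩ := LinearMap.BilinForm.exists_orthogonal_basis
    (LinearMap.BilinForm.isSymm_iff.1 hsymm)
  have hv0 (i) : b (v i) (v i) ≠ 0 :=
    LinearMap.IsOrthoᵢ.not_isOrtho_basis_self_of_separatingLeft hv hb.1 i
  choose r hr using fun i => IsAlgClosed.exists_eq_mul_self (b (v i) (v i))
  have hr0 (i) : r i ≠ 0 := fun h => hv0 i (by rw [hr, h, mul_zero])
  refine ⟨v.isUnitSMul fun i => (inv_ne_zero (hr0 i)).isUnit, fun i j => ?_⟩
  simp only [Module.Basis.isUnitSMul_apply, map_smul, LinearMap.smul_apply, smul_eq_mul]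
  split_ifs with hij
  · subst hij
    rw [hr]
    field_simp [hr0 i]
  · have : b (v i) (v j) = 0 := hv hij
    rw [this, mul_zero, mul_zero]

namespace IsOrthonormalBasis

theorem apply_eq_dotProduct (hf : IsOrthonormalBasis b f) (v w : V) :
    b v w = f.equivFun v ⬝ᵥ f.equivFun w := by
  conv_lhs => rw [← f.sum_equivFun v, ← f.sum_equivFun w]
  simp only [map_sum, map_smul, LinearMap.sum_apply, LinearMap.smul_apply, hf _ _, smul_eq_mul,
    mul_ite, mul_one, mul_zero, Finset.mem_univ, if_true, Finset.sum_ite_eq',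
    dotProduct]
  exact Finset.sum_congr rfl fun i _ => mul_comm _ _

theorem transpose_toMatrix_mul (hf : IsOrthonormalBasis b f) (g h : Module.End k V) (i j : n) :
    ((LinearMap.toMatrix f f g).transpose * LinearMap.toMatrix f f h) i j =
      b (g (f i)) (h (f j)) := by
  rw [hf.apply_eq_dotProduct]
  simp [Matrix.mul_apply, LinearMap.toMatrix_apply, dotProduct]

theorem toMatrix_mem_specialOrthogonal (hf : IsOrthonormalBasis b f) (g : specialOrthogonal b) :
    (LinearMap.toMatrix f f (g : V ≃ₗ[k] V).toLinearMap).transpose *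
      LinearMap.toMatrix f f (g : V ≃ₗ[k] V).toLinearMap = 1 := by
  ext i j
  rw [hf.transpose_toMatrix_mul, Matrix.one_apply, ← hf i j]
  exact g.2.2 _ _

theorem exists_specialOrthogonal (hf : IsOrthonormalBasis b f) {G : Matrix n n k}
    (hG : G.transpose * G = 1) (hdet : G.det = 1) :
    ∃ g : specialOrthogonal b, LinearMap.toMatrix f f (g : V ≃ₗ[k] V).toLinearMap = G := by
  let e := Matrix.toLinearEquiv f G (hdet ▸ isUnit_one)
  have he : e.toLinearMap = Matrix.toLin f f G := rfl
  have heT : LinearMap.toMatrix f f e.toLinearMap = G := by rw [he, LinearMap.toMatrix_toLin]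
  have hev (v : V) : f.equivFun (e v) = G.mulVec (f.equivFun v) := by
    rw [← heT]
    exact (LinearMap.toMatrix_mulVec_repr f f e.toLinearMap v).symm
  refine ⟨⟨e, ?_, fun v w => ?_⟩, heT⟩
  · rw [← Units.val_inj, LinearEquiv.coe_det, ← LinearMap.det_toMatrix f, heT, hdet, Units.val_one]
  · rw [hf.apply_eq_dotProduct, hf.apply_eq_dotProduct, hev, hev, Matrix.dotProduct_mulVec,
      Matrix.vecMul_mulVec, hG, Matrix.vecMul_one]

theorem toMatrix_conj (hf : IsOrthonormalBasis b f) (g : specialOrthogonal b)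
    (x : Module.End k V) :
    LinearMap.toMatrix f f ((g : V ≃ₗ[k] V).conj x) =
      LinearMap.toMatrix f f (g : V ≃ₗ[k] V).toLinearMap * LinearMap.toMatrix f f x *
        (LinearMap.toMatrix f f (g : V ≃ₗ[k] V).toLinearMap).transpose := by
  have h1 := hf.toMatrix_mem_specialOrthogonal g
  have h2 : LinearMap.toMatrix f f (g : V ≃ₗ[k] V).toLinearMap *
      LinearMap.toMatrix f f (g : V ≃ₗ[k] V).symm.toLinearMap = 1 := by
    rw [← LinearMap.toMatrix_comp, LinearEquiv.comp_coe, LinearEquiv.symm_trans_self,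
      LinearEquiv.refl_toLinearMap, LinearMap.toMatrix_id]
  rw [LinearEquiv.conj_apply, LinearMap.toMatrix_comp f f f, LinearMap.toMatrix_comp f f f,
    left_inv_eq_right_inv h1 h2]

theorem toMatrix_transpose_of_mem_soLie (hf : IsOrthonormalBasis b f) (x : soLie b) :
    (LinearMap.toMatrix f f (x : Module.End k V)).transpose =
      -LinearMap.toMatrix f f (x : Module.End k V) := by
  have hx : b.IsSkewAdjoint (x : Module.End k V) := (LinearMap.mem_skewAdjointSubmodule _).1 x.2
  ext i j
  have h1 := hf.transpose_toMatrix_mul (x : Module.End k V) LinearMap.id i j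
  have h2 := hf.transpose_toMatrix_mul LinearMap.id (x : Module.End k V) i j
  rw [LinearMap.toMatrix_id, Matrix.mul_one] at h1
  rw [LinearMap.toMatrix_id, Matrix.transpose_one, Matrix.one_mul] at h2
  rw [h1, Matrix.neg_apply, h2, LinearMap.id_apply, LinearMap.id_apply, hx (f i) (f j),
    Pi.neg_apply, map_neg]

/-- The upper bound on the dimension of a conjugacy class: the codimension of the centralizer in
the Lie algebra. -/
theorem zariskiDim_conjClass_le [Infinite k] (hf : IsOrthonormalBasis b f) (h2 : (2 : k) ≠ 0)
    (x : Module.End k V) (d : ℕ)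
    (hd : Module.finrank k (signedCentralizer (-1 : k) (0 : Matrix n n k)) ≤
      d + Module.finrank k (signedCentralizer (-1 : k) (LinearMap.toMatrix f f x))) :
    zariskiDim (k := k) (conjClass b x) ≤ d := by
  refine zariskiDim_le_of_orbit h2 (LinearMap.toMatrix f f) _ _ ?_ d hd
  rintro _ ⟨g, rfl⟩
  exact ⟨_, hf.toMatrix_mem_specialOrthogonal g, hf.toMatrix_conj g x⟩

end IsOrthonormalBasis

end Orthonormal

/-! ### Submodules of the symmetric square -/

section Subrep

variable {k : Type*} [Field k] {V : Type*} [AddCommGroup V] [Module k V]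
  {b : LinearMap.BilinForm k V} {n : Type*} [Fintype n]
  {f : Module.Basis n k V}

variable (f) in
/-- The elements of the symmetric square that correspond to matrices of trace zero. -/
def traceZeroPart : Submodule k (SymSq k V) :=
  LinearMap.ker (Matrix.traceLinearMap n k k ∘ₗ symSqToMatrix f)

theorem mem_traceZeroPart {w : SymSq k V} :
    w ∈ traceZeroPart f ↔ (symSqToMatrix f w).trace = 0 := by
  rw [traceZeroPart, LinearMap.mem_ker]
  rfl

theorem finrank_symSq_le_finrank_traceZeroPart_add_one [FiniteDimensional k V] :
    Module.finrank k (SymSq k V) ≤ Module.finrank k (traceZeroPart f) + 1 := by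
  have h1 := LinearMap.finrank_range_add_finrank_ker
    (Matrix.traceLinearMap n k k ∘ₗ symSqToMatrix f)
  have h2 : Module.finrank k (LinearMap.range (Matrix.traceLinearMap n k k ∘ₗ symSqToMatrix f)) ≤
      1 := (Submodule.finrank_le _).trans (Module.finrank_self k).le
  rw [traceZeroPart]
  omega

variable [DecidableEq n]

variable (f) in
/-- The elements of the symmetric square that correspond to scalar matrices. -/
def scalarPart : Submodule k (SymSq k V) :=
  (Submodule.span k {(1 : Matrix n n k)}).comap (symSqToMatrix f)

theorem mem_scalarPart {w : SymSq k V} :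
    w ∈ scalarPart f ↔ ∃ c : k, c • (1 : Matrix n n k) = symSqToMatrix f w := by
  rw [scalarPart, Submodule.mem_comap, Submodule.mem_span_singleton]

theorem symSqToMatrix_symSqRep (g : specialOrthogonal b) (w : SymSq k V) :
    symSqToMatrix f (symSqRep b g w) =
      LinearMap.toMatrix f f (g : V ≃ₗ[k] V).toLinearMap * symSqToMatrix f w *
        (LinearMap.toMatrix f f (g : V ≃ₗ[k] V).toLinearMap).transpose :=
  symSqToMatrix_symSqMap f _ w

theorem symSqRep_of_mem_scalarPart (h2 : (2 : k) ≠ 0) (hf : IsOrthonormalBasis b f)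
    (g : specialOrthogonal b) {w : SymSq k V} (hw : w ∈ scalarPart f) : symSqRep b g w = w := by
  obtain ⟨c, hc⟩ := mem_scalarPart.1 hw
  refine symSqToMatrix_injective f h2 ?_
  rw [symSqToMatrix_symSqRep, ← hc, Matrix.mul_smul, Matrix.mul_one, Matrix.smul_mul,
    mul_eq_one_comm.1 (hf.toMatrix_mem_specialOrthogonal g)]

theorem trace_symSqRep (hf : IsOrthonormalBasis b f) (g : specialOrthogonal b) (w : SymSq k V) :
    (symSqToMatrix f (symSqRep b g w)).trace = (symSqToMatrix f w).trace := by
  rw [symSqToMatrix_symSqRep, Matrix.trace_mul_comm, ← Matrix.mul_assoc,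
    hf.toMatrix_mem_specialOrthogonal g, Matrix.one_mul]

/-- The alternative for a submodule of the symmetric square: it consists of scalar matrices or
contains all the matrices of trace zero. -/
theorem traceZeroPart_le [IsAlgClosed k] (h2 : (2 : k) ≠ 0) (hn : 5 ≤ Fintype.card n)
    (hf : IsOrthonormalBasis b f) {U : Subrepresentation (symSqRep b)}
    (hU : ¬ U.toSubmodule ≤ scalarPart f) : traceZeroPart f ≤ U.toSubmodule := by
  obtain ⟨w, hw, hns⟩ := SetLike.not_le_iff_exists.1 hU
  intro v hv
  have hst : IsRotationStable (U.toSubmodule.map (symSqToMatrix f)) := by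
    rintro G hG hdet _ ⟨u, hu, rfl⟩
    obtain ⟨g, rfl⟩ := hf.exists_specialOrthogonal hG hdet
    exact ⟨_, U.apply_mem_toSubmodule g hu, symSqToMatrix_symSqRep g u⟩
  obtain ⟨u, hu, huv⟩ := hst.mem_of_trace_eq_zero h2 hn
    (by rintro _ ⟨u, -, rfl⟩; exact symSqToMatrix_transpose f u)
    (Submodule.mem_map_of_mem hw) (fun c hc => hns (mem_scalarPart.2 ⟨c, hc.symm⟩))
    (symSqToMatrix_transpose f v) (mem_traceZeroPart.1 hv)
  rwa [symSqToMatrix_injective f h2 huv] at hu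

theorem le_scalarPart_of_actsNontrivially [IsAlgClosed k] (h2 : (2 : k) ≠ 0)
    (hn : 5 ≤ Fintype.card n) (hf : IsOrthonormalBasis b f)
    {A B : Subrepresentation (symSqRep b)} (h : ActsNontrivially A B) :
    A.toSubmodule ≤ scalarPart f := by
  by_contra hA
  obtain ⟨g, w, -, hgw⟩ := h
  refine hgw (traceZeroPart_le h2 hn hf hA (mem_traceZeroPart.2 ?_))
  rw [map_sub, Matrix.trace_sub, trace_symSqRep hf, sub_self]

theorem traceZeroPart_le_of_actsNontrivially [IsAlgClosed k] (h2 : (2 : k) ≠ 0)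
    (hn : 5 ≤ Fintype.card n) (hf : IsOrthonormalBasis b f)
    {A B : Subrepresentation (symSqRep b)} (h : ActsNontrivially A B) :
    traceZeroPart f ≤ B.toSubmodule := by
  refine traceZeroPart_le h2 hn hf fun hB => ?_
  obtain ⟨g, w, hw, hgw⟩ := h
  refine hgw ?_
  rw [symSqRep_of_mem_scalarPart h2 hf g (hB hw), sub_self]
  exact A.toSubmodule.zero_mem

/-- The composition factor is the quotient of the matrices of trace zero by the scalar matrices
among them. -/
theorem exists_covBy_actsNontrivially [IsAlgClosed k] (h2 : (2 : k) ≠ 0)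
    (hn : 5 ≤ Fintype.card n) (hf : IsOrthonormalBasis b f) :
    ∃ A B : Subrepresentation (symSqRep b), A ⋖ B ∧ ActsNontrivially A B := by
  let B : Subrepresentation (symSqRep b) := ⟨traceZeroPart f, fun g w hw => by
    rw [mem_traceZeroPart] at hw ⊢
    rw [trace_symSqRep hf, hw]⟩
  let A : Subrepresentation (symSqRep b) := ⟨scalarPart f ⊓ traceZeroPart f, fun g w hw => by
    rwa [symSqRep_of_mem_scalarPart h2 hf g hw.1]⟩
  have hAB : A ≤ B := fun w hw => hw.2
  have hact : ActsNontrivially A B := by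
    -- Changing the signs of coordinates `a` and `c` negates the product of those at `a` and `a'`.
    obtain ⟨a, a', c, ha, hac, hac'⟩ : ∃ a a' c : n, a ≠ a' ∧ a ≠ c ∧ a' ≠ c := by
      obtain ⟨a, a', c, h⟩ := Fintype.two_lt_card_iff.1 (by omega : 2 < Fintype.card n)
      exact ⟨a, a', c, h⟩
    obtain ⟨g, hg⟩ := hf.exists_specialOrthogonal (signFlip_mul_self (k := k) a c)
      (det_signFlip hac)
    have hC : symSqToMatrix f (symMk (f a) (f a')) =
        symProd (Pi.single a (1 : k)) (Pi.single a' 1) := by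
      rw [symSqToMatrix_symMk]
      simp [f.equivFun_apply, Finsupp.single_eq_pi_single]
    have hval : symProd (Pi.single a (1 : k)) (Pi.single a' 1) a a' = 1 := by
      simp [symProd, Matrix.vecMulVec_apply, ha, ha.symm]
    refine ⟨g, symMk (f a) (f a'), mem_traceZeroPart.2 ?_, fun h => ?_⟩
    · rw [hC]
      simp [symProd, Matrix.trace_add, Matrix.trace_vecMulVec, ha, ha.symm]
    · obtain ⟨r, hr⟩ := mem_scalarPart.1 h.1
      rw [map_sub, symSqToMatrix_symSqRep, hg, hC] at hr
      have := congrFun (congrFun hr a) a'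
      rw [Matrix.sub_apply, signFlip_conj_apply, hval] at this
      simp [ha, ha.symm, hac, hac'] at this
      exact h2 (by linear_combination this)
  have hne : A ≠ B := by
    rintro h
    obtain ⟨g, w, hw, hgw⟩ := hact
    exact hgw (h ▸ B.toSubmodule.sub_mem (B.apply_mem_toSubmodule g hw) hw)
  refine ⟨A, B, ⟨lt_of_le_of_ne hAB hne, fun C hAC hCB => ?_⟩, hact⟩
  by_cases hC : C.toSubmodule ≤ scalarPart f
  · exact hAC.not_ge fun w hw => ⟨hC hw, hCB.le hw⟩
  · exact hCB.not_ge (traceZeroPart_le h2 hn hf hC)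

/-- The square of the isotropic vector `e 0` is a highest weight vector. -/
theorem hasHighestWeightTwoLambda_of_le (hf : IsOrthonormalBasis b f) (h2 : (2 : k) ≠ 0)
    (hn : 5 ≤ Fintype.card n) {A B : Subrepresentation (symSqRep b)}
    (hA : A.toSubmodule ≤ scalarPart f) (hB : traceZeroPart f ≤ B.toSubmodule) :
    HasHighestWeightTwoLambda A B := by
  intro m e he
  have hm : m + 1 = Fintype.card n := by
    rw [← Module.finrank_eq_card_basis f, Module.finrank_eq_card_basis e, Fintype.card_fin]
  have hiso : b (e 0) (e 0) = 0 := by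
    rw [he, if_neg]
    rw [Fin.ext_iff, Fin.val_rev]
    simp
    omega
  have hM : symSqToMatrix f (symMk (e 0) (e 0)) =
      symProd (f.equivFun (e 0)) (f.equivFun (e 0)) := symSqToMatrix_symMk f _ _
  refine ⟨symMk (e 0) (e 0), hB (mem_traceZeroPart.2 ?_), fun h => ?_, fun g _ c hc => ?_⟩
  · rw [hM, symProd, Matrix.trace_add, Matrix.trace_vecMulVec, ← hf.apply_eq_dotProduct, hiso,
      add_zero]
  · obtain ⟨r, hr⟩ := mem_scalarPart.1 (hA h)
    rw [hM] at hr
    -- A scalar matrix of rank at most one is zero, which contradicts `e 0 ≠ 0`.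
    have hent (i j : n) : r * (1 : Matrix n n k) i j =
        2 * (f.equivFun (e 0) i * f.equivFun (e 0) j) := by
      have := congrFun (congrFun hr i) j
      rw [Matrix.smul_apply, smul_eq_mul, symProd, Matrix.add_apply, Matrix.vecMulVec_apply] at this
      rw [this, two_mul]
    refine e.ne_zero 0 (f.equivFun.map_eq_zero_iff.1 (funext fun i => ?_))
    obtain ⟨j, hj⟩ := Fintype.exists_ne_of_one_lt_card (by omega : 1 < Fintype.card n) i
    have hij := hent i j
    have hii := hent i i
    have hjj := hent j j
    rw [Matrix.one_apply_ne hj.symm, mul_zero] at hij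
    rw [Matrix.one_apply_eq, mul_one] at hii hjj
    by_contra hi
    have hj0 : f.equivFun (e 0) j = 0 := by
      exact ((mul_eq_zero.1 hij.symm).resolve_left h2 |> mul_eq_zero.1).resolve_left hi
    rw [hj0, mul_zero, mul_zero] at hjj
    rw [hjj] at hii
    exact mul_ne_zero h2 (mul_ne_zero hi hi) hii.symm
  · have : symSqRep b g (symMk (e 0) (e 0)) = c ^ 2 • symMk (e 0) (e 0) := by
      change symMk ((g : V ≃ₗ[k] V) (e 0)) ((g : V ≃ₗ[k] V) (e 0)) = _
      rw [hc, symMk, TensorProduct.smul_tmul_smul, map_smul, ← sq]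
      rfl
    rw [this, sub_self]
    exact A.toSubmodule.zero_mem

theorem finrank_map_mkQ_add {M : Type*} [AddCommGroup M] [Module k M] [FiniteDimensional k M]
    {p q : Submodule k M} (h : p ≤ q) :
    Module.finrank k (q.map p.mkQ) + Module.finrank k p = Module.finrank k q := by
  have h1 := LinearMap.finrank_range_add_finrank_ker (p.mkQ.domRestrict q)
  have h3 : LinearMap.ker (p.mkQ.domRestrict q) = p.submoduleOf q := by
    rw [LinearMap.ker_domRestrict, Submodule.ker_mkQ]
    rfl
  rw [LinearMap.range_domRestrict, h3, (Submodule.submoduleOfEquivOfLe h).finrank_eq] at h1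
  exact h1

/-- The dimension estimate for all subquotients `B / A` such that `A` consists of scalar matrices
and `B` contains the matrices of trace zero. -/
theorem zariskiDim_add_finrank_killedBy_lt [Infinite k] [FiniteDimensional k V]
    (h2 : (2 : k) ≠ 0) (hn : 5 ≤ Fintype.card n) (hf : IsOrthonormalBasis b f)
    {A B : Subrepresentation (symSqRep b)}
    (hA : A.toSubmodule ≤ scalarPart f) (hB : traceZeroPart f ≤ B.toSubmodule)
    {x : soLie b} (hx : x ≠ 0) :
    zariskiDim (k := k) (conjClass b (x : Module.End k V)) +
      (Module.finrank k (killedBy A B x) : WithBot ℕ∞) <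
      (Module.finrank k (Subquotient A B) : WithBot ℕ∞) := by
  set X := LinearMap.toMatrix f f (x : Module.End k V) with hXdef
  have hXt : X.transpose = -X := hf.toMatrix_transpose_of_mem_soLie x
  have hX0 : X ≠ 0 := fun h => hx (Subtype.ext ((LinearMap.toMatrix f f).map_eq_zero_iff.1 h))
  have hder (w : SymSq k V) : symSqToMatrix f (symSqDer (x : Module.End k V) w) =
      X * symSqToMatrix f w - symSqToMatrix f w * X := by
    rw [symSqToMatrix_symSqDer, ← hXdef, hXt, Matrix.mul_neg, sub_eq_add_neg]
  set Z := A.toSubmodule.comap (symSqDer (x : Module.End k V)) with hZ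
  have hAZ : A.toSubmodule ≤ Z := by
    intro w hw
    obtain ⟨c, hc⟩ := mem_scalarPart.1 (hA hw)
    have : symSqDer (x : Module.End k V) w = 0 := symSqToMatrix_injective f h2 (by
      rw [hder, ← hc, Matrix.mul_smul, Matrix.mul_one, Matrix.smul_mul, Matrix.one_mul, sub_self,
        map_zero])
    rw [hZ, Submodule.mem_comap, this]
    exact A.toSubmodule.zero_mem
  have e1 : Module.finrank k (killedBy A B x) +
      Module.finrank k (A.toSubmodule.submoduleOf B.toSubmodule) =
      Module.finrank k (Z.submoduleOf B.toSubmodule) :=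
    finrank_map_mkQ_add (Submodule.comap_mono hAZ)
  have e2 : Module.finrank k (Subquotient A B) +
      Module.finrank k (A.toSubmodule.submoduleOf B.toSubmodule) =
      Module.finrank k B.toSubmodule := Submodule.finrank_quotient_add_finrank _
  have e3 : Module.finrank k (Z.submoduleOf B.toSubmodule) ≤
      Module.finrank k (scalarCommutator X) := by
    let T : Z.submoduleOf B.toSubmodule →ₗ[k] scalarCommutator X :=
      LinearMap.codRestrict _
        (symSqToMatrix f ∘ₗ B.toSubmodule.subtype ∘ₗ (Z.submoduleOf B.toSubmodule).subtype)
        fun w => mem_scalarCommutator.2 ⟨symSqToMatrix_transpose f _, by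
          obtain ⟨c, hc⟩ := mem_scalarPart.1 (hA w.2)
          exact ⟨c, hc.trans (hder _)⟩⟩
    refine LinearMap.finrank_le_finrank_of_injective (f := T) fun u v huv => ?_
    exact Subtype.ext (Subtype.ext (symSqToMatrix_injective f h2 (congrArg Subtype.val huv)))
  have e4 := Submodule.finrank_mono hB
  have e5 := finrank_symSq_le_finrank_traceZeroPart_add_one (f := f)
  rw [finrank_symSq f h2] at e5
  have e6 := finrank_scalarCommutator_add_le h2 hn hXt hX0
  have e7 : Module.finrank k (signedCentralizer (-1 : k) X) ≤
      Module.finrank k (signedCentralizer (-1 : k) (0 : Matrix n n k)) :=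
    Submodule.finrank_mono fun Y hY => mem_signedCentralizer.2
      ⟨(mem_signedCentralizer.1 hY).1, by simp⟩
  obtain ⟨d, hd⟩ := Nat.exists_eq_add_of_le' e7
  refine (add_le_add_left
    (hf.zariskiDim_conjClass_le h2 (x : Module.End k V) d hd.le) _).trans_lt ?_
  have : d + Module.finrank k (killedBy A B x) < Module.finrank k (Subquotient A B) := by omega
  exact_mod_cast this

end Subrep

end SymSqSO

end

theorem mainTheorem6 {k : Type*} [Field k] [IsAlgClosed k] (hk : ringChar k ≠ 2)
    {V : Type*} [AddCommGroup V] [Module k V] [FiniteDimensional k V]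
    (hn : 5 ≤ Module.finrank k V)
    (b : LinearMap.BilinForm k V) (hsymm : b.IsSymm) (hnondeg : b.Nondegenerate) :
    (∃ A B : Subrepresentation (SymSqSO.symSqRep b), A ⋖ B ∧ SymSqSO.ActsNontrivially A B) ∧
    ∀ A B : Subrepresentation (SymSqSO.symSqRep b), A ⋖ B → SymSqSO.ActsNontrivially A B →
      SymSqSO.HasHighestWeightTwoLambda A B ∧
      ∀ x : SymSqSO.soLie b,
        (x ≠ 0 ∧ IsNilpotent (x : Module.End k V)) ∨
        (x ∉ LieAlgebra.center k (SymSqSO.soLie b) ∧ (x : Module.End k V).IsSemisimple) →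
        SymSqSO.zariskiDim (k := k) (SymSqSO.conjClass b (x : Module.End k V)) +
          (Module.finrank k (SymSqSO.killedBy A B x) : WithBot ℕ∞) <
          (Module.finrank k (SymSqSO.Subquotient A B) : WithBot ℕ∞) := by
  have h2 : (2 : k) ≠ 0 := Ring.two_ne_zero hk
  have : Infinite k := IsAlgClosed.instInfinite
  obtain ⟨f, hf⟩ := SymSqSO.exists_isOrthonormalBasis h2 hsymm hnondeg
  have hcard : 5 ≤ Fintype.card (Fin (Module.finrank k V)) := by rwa [Fintype.card_fin]
  refine ⟨SymSqSO.exists_covBy_actsNontrivially h2 hcard hf, fun A B hcov hact => ?_⟩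
  have hA := SymSqSO.le_scalarPart_of_actsNontrivially h2 hcard hf hact
  have hB := SymSqSO.traceZeroPart_le_of_actsNontrivially h2 hcard hf hact
  refine ⟨SymSqSO.hasHighestWeightTwoLambda_of_le hf h2 hcard hA hB, fun x hx => ?_⟩
  refine SymSqSO.zariskiDim_add_finrank_killedBy_lt h2 hcard hf hA hB ?_
  rcases hx with ⟨hx, -⟩ | ⟨hx, -⟩
  · exact hx
  · rintro rfl
    exact hx (zero_mem _)
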